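/- Let $\mathcal L$ be any fixed linear equation $a_1x_1+\dots+a_\ell x_\ell=b$ with $a_1,\dots,a_\ell,b\in\mathbb Z$. A solution $(x_1,\dots,x_\ell)$ of $\mathcal L$ is *trivial* if $\{1,\dots,\ell\}$ has a partition $P_1,\dots,P_r$ such that $x_i=x_j$ whenever $i,j$ lie in the same class, and $\sum_{i\in P_s}a_i=0$ for each $s$. A set of integers is *$\mathcal L$-free* if it contains no non-trivial solution of $\mathcal L$ (the entries of a solution need not be distinct). Consider the problem #Given-Size $\mathcal L$-Free Subset: given a finite set $A\subseteq\mathbb Z$ and an integer $k\ge 0$, determine the number $N_{\mathcal L}(A,k)$ of $\mathcal L$-free subsets of $A$ of cardinality exactly $k$. An instance $I=(A,k)$ is given as a list of the elements of $A$ (in any order, without repetition), followed by $k$, all numbers being written in binary; $|I|$ denotes the length of this string. Theorem. For every fixed linear equation $\mathcal L$, the problem #Given-Size $\mathcal L$-Free Subset, parameterised by $\kappa(A,k)=|A|-k$ (read as $0$ if $k>|A|$), belongs to $\mathrm{FPT}$. That is, $\kappa$ is computable in polynomial time, and there are a computable function $f:\mathbb N\to\mathbb N$, a polynomial $p$ and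 an algorithm (a multi-tape Turing machine), all depending only on $\mathcal L$, such that on every instance $I=(A,k)$ the algorithm outputs $N_{\mathcal L}(A,k)$ in binary after at most $f(\kappa(A,k))\cdot p(|I|)$ steps. -/

import Mathlib

namespace SolutionFree

/-- A linear equation `a₁ x₁ + ⋯ + a_ℓ x_ℓ = b` with integer coefficients. -/
structure LinearEquation where
  /-- the number `ℓ` of variables -/
  arity : ℕ
  /-- the coefficients `a₁, …, a_ℓ` -/
  coeff : Fin arity → ℤ
  /-- the right-hand side `b` -/
  rhs : ℤ

namespace LinearEquation

/-- The tuple `x` is a solution of the equation. -/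
def IsSolution (L : LinearEquation) (x : Fin L.arity → ℤ) : Prop :=
  ∑ i, L.coeff i * x i = L.rhs

/-- A tuple is trivial if the set of indices can be partitioned into classes such that `x` is
constant on each class and the coefficients of each class sum to zero. -/
def IsTrivial (L : LinearEquation) (x : Fin L.arity → ℤ) : Prop :=
  ∃ P : Finpartition (Finset.univ : Finset (Fin L.arity)),
    ∀ C ∈ P.parts, (∀ i ∈ C, ∀ j ∈ C, x i = x j) ∧ ∑ i ∈ C, L.coeff i = 0

/-- A set of integers is `L`-free if it contains no non-trivial solution of `L`
(the entries of a solution need not be distinct). -/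
def IsFree (L : LinearEquation) (S : Set ℤ) : Prop :=
  ∀ x : Fin L.arity → ℤ, (∀ i, x i ∈ S) → L.IsSolution x → L.IsTrivial x

open Classical in
/-- The number of `L`-free subsets of `A` that have exactly `k` elements. -/
noncomputable def numFree (L : LinearEquation) (A : Finset ℤ) (k : ℕ) : ℕ :=
  ((A.powersetCard k).filter (fun B => L.IsFree (B : Set ℤ))).card

end LinearEquation

/-- An input `(A, k)`. The finite set `A` is presented as a list of its elements, without
repetition and in an arbitrary order. -/
structure Instance where
  /-- the elements of `A` -/
  elems : List ℤ
  /-- no element is listed twice -/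
  nodup : elems.Nodup
  /-- the prescribed size `k` of the subsets -/
  k : ℕ

/-- The set `A` of an instance `(A, k)`. -/
def Instance.set (I : Instance) : Finset ℤ := I.elems.toFinset

/-- The input alphabet: the two binary digits, a minus sign, and a comma. -/
inductive Symbol
  | bit (b : Bool)
  | minus
  | comma
  deriving DecidableEq, Fintype

/-- Binary representation of a natural number, least significant digit first (the number zero is
the empty string). -/
def encodeNat (n : ℕ) : List Symbol := (Computability.encodeNat n).map Symbol.bit

/-- An integer: a minus sign if it is negative, followed by its absolute value in binary. -/
def encodeInt (z : ℤ) : List Symbol :=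
  (if z < 0 then [Symbol.minus] else []) ++ encodeNat z.natAbs

/-- The string `a₁,a₂,…,aₙ,k` that represents the instance `({a₁, …, aₙ}, k)`. Its length is the
size of the instance. -/
def Instance.encode (I : Instance) : List Symbol :=
  I.elems.flatMap (fun z => encodeInt z ++ [Symbol.comma]) ++ encodeNat I.k

/-- The function `F`, with arguments encoded by `enc` and values written in binary, is computed by
a single (multi-stack) Turing machine that halts on each argument `x` with the value `F x` as its
output after at most `t x` steps. All stack alphabets are finite. -/
def ComputableWithin {α Γ : Type} (enc : α → List Γ) (F t : α → ℕ) : Prop :=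
  ∃ M : Turing.TM2ComputableAux Γ Bool,
    (∀ s : M.tm.K, Finite (M.tm.Γ s)) ∧
    ∀ x : α, Nonempty (Turing.TM2OutputsInTime M.tm
      ((enc x).map M.inputAlphabet.symm)
      (some ((Computability.encodeNat (F x)).map M.outputAlphabet.symm))
      (t x))

/-- Computability in time polynomial in the length of the encoded argument. -/
def ComputableInPolyTime {α Γ : Type} (enc : α → List Γ) (F : α → ℕ) : Prop :=
  ∃ p : Polynomial ℕ, ComputableWithin enc F (fun x => p.eval (enc x).length)

/-- The counting problem `count`, parameterised by `κ`, belongs to FPT: `κ` is a parameterisation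
(a polynomial-time computable mapping to the natural numbers), and some algorithm computes
`count x` from each instance `x` of size `n` in time at most `f (κ x) * p n`, where `f` is a
computable function and `p` is a polynomial. -/
def CountingInFPT {α Γ : Type} (enc : α → List Γ) (count κ : α → ℕ) : Prop :=
  ComputableInPolyTime enc κ ∧
  ∃ (f : ℕ → ℕ) (p : Polynomial ℕ), Computable f ∧
    ComputableWithin enc count (fun x => f (κ x) * p.eval (enc x).length)

end SolutionFree

/-!
Deleting a set `D` from `A` leaves an `L`-free set if and only if `D` meets the set of entries of
every non-trivial solution of `L` in `A`. The number of `L`-free subsets of size `k` is therefore the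
number of hitting sets of size `d = |A| - k` of a family of sets with at most `ℓ` elements, where `ℓ`
is the number of variables of `L`; the family is polynomially large since `L` is fixed. Hitting sets
are counted by a search tree (`hitCount_erase`): for an element `v` of the first set of the family,
either `v` is chosen, and all sets that contain `v` disappear, or `v` is discarded, and is removed from
all sets. When no set remains, a binomial coefficient counts the ways to complete the choice. A choice
decreases `d`, and at most `ℓ` elements can be discarded in a row before a set becomes empty, so the
tree has depth at most `(ℓ + 1) * (d + 1)` (`depth_le`, `levelCount_eq`) and at most
`2 ^ ((ℓ + 1) * (d + 1))` nodes on each level, each of which is processed in polynomial time.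

To obtain Turing machines with a bound on their running time, structured programs that act on a few
binary stacks (`Prog`, with the semantics `Exec`) are compiled to stack machines with the same number
of steps (`Prog.iterate_step_of_exec`). Values are binary trees, stored on the main stack by a
self-delimiting prefix code, so that the usual operations on pairs and lists become short programs.
On top of this, `PolyTime m f` says that some program computes `f` in time polynomial in a measure `m`
and the size of the argument. This class is closed under composition, pairing, case distinction and
iteration along a list, as long as the intermediate results stay small (`PolyTime.foldl`). All parts
of the algorithm are in this class with `m = 0`, except for the exploration of the search tree, which
takes time polynomial in `m = 2 ^ ((ℓ + 1) * (d + 1))` (`PolyTime.frontier`). A polynomial in `m` and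
the input length is bounded by a product of a function of `d` and a polynomial in the input length.
-/

namespace SolutionFree

/-! ### Structured stack programs and their translation to Turing machines -/

/-- The four binary work stacks of a program. -/
inductive Work
  | main
  | rev
  | aux
  | cnt
  deriving DecidableEq

instance : Fintype Work := ⟨{.main, .rev, .aux, .cnt}, fun w => by cases w <;> decide⟩

/-- All stacks of a program: the input, the output and the work stacks. -/
inductive Stack
  | inp
  | out
  | work (w : Work)
  deriving DecidableEq, Fintype

/-- The stack alphabets. -/
def Alph : Stack → Type
  | .inp => Symbol
  | .out => Bool
  | .work _ => Bool

/-- The finite control: the input symbol and the bit that were read last, and a flag. -/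
structure Reg where
  /-- the last symbol read from the input -/
  sym : Option Symbol
  /-- the last bit read from a work stack -/
  bit : Option Bool
  /-- an auxiliary bit -/
  flag : Option Bool
  deriving DecidableEq, Fintype

/-- The contents of all stacks. -/
structure Mem where
  /-- the input stack -/
  inp : List Symbol
  /-- the output stack -/
  out : List Bool
  /-- the stack that holds the values computed so far -/
  main : List Bool
  /-- an auxiliary stack -/
  rev : List Bool
  /-- an auxiliary stack -/
  aux : List Bool
  /-- a stack used as a unary counter -/
  cnt : List Bool

namespace Mem

/-- The contents of a work stack. -/
def get (s : Mem) : Work → List Bool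
  | .main => s.main
  | .rev => s.rev
  | .aux => s.aux
  | .cnt => s.cnt

/-- Replace the contents of a work stack. -/
def set (s : Mem) : Work → List Bool → Mem
  | .main, l => ⟨s.inp, s.out, l, s.rev, s.aux, s.cnt⟩
  | .rev, l => ⟨s.inp, s.out, s.main, l, s.aux, s.cnt⟩
  | .aux, l => ⟨s.inp, s.out, s.main, s.rev, l, s.cnt⟩
  | .cnt, l => ⟨s.inp, s.out, s.main, s.rev, s.aux, l⟩

/-- The contents of the stacks as a family indexed by the stacks. -/
def stk (s : Mem) : ∀ k, List (Alph k)
  | .inp => s.inp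
  | .out => s.out
  | .work w => s.get w

theorem update_work (s : Mem) (w : Work) (l : List Bool) :
    Function.update s.stk (.work w) l = (s.set w l).stk := by
  funext k
  rcases k with _ | _ | w'
  · cases w <;> rfl
  · cases w <;> rfl
  · cases w <;> cases w' <;> rfl

theorem update_inp (s : Mem) (l : List Symbol) :
    Function.update s.stk .inp l = Mem.stk { s with inp := l } := by
  funext k
  rcases k with _ | _ | w' <;> [rfl; rfl; (cases w' <;> rfl)]

theorem update_out (s : Mem) (l : List Bool) :
    Function.update s.stk .out l = Mem.stk { s with out := l } := by
  funext k
  rcases k with _ | _ | w' <;> [rfl; rfl; (cases w' <;> rfl)]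

end Mem

/-- Structured programs that act on the stacks. -/
inductive Prog
  /-- push a bit that is determined by the registers -/
  | push (k : Work) (f : Reg → Bool)
  /-- pop a bit into the register `bit` (which becomes `none` if the stack is empty) -/
  | pop (k : Work)
  /-- copy the topmost bit to the register `bit` -/
  | peek (k : Work)
  /-- pop an input symbol into the register `sym` -/
  | read
  /-- push a bit to the output stack -/
  | write (f : Reg → Bool)
  /-- change the registers -/
  | load (f : Reg → Reg)
  /-- sequential composition -/
  | seq (p q : Prog)
  /-- conditional -/
  | ite (b : Reg → Bool) (p q : Prog)
  /-- loop -/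
  | loop (b : Reg → Bool) (p : Prog)

infixr:60 " ;; " => Prog.seq

/-- `Exec p v s t v' s'`: run with registers `v` and stacks `s`, the program `p` stops after
exactly `t` steps with registers `v'` and stacks `s'`. -/
inductive Exec : Prog → Reg → Mem → ℕ → Reg → Mem → Prop
  | push {k f v s} : Exec (.push k f) v s 1 v (s.set k (f v :: s.get k))
  | pop {k v s} : Exec (.pop k) v s 1 ⟨v.sym, (s.get k).head?, v.flag⟩ (s.set k (s.get k).tail)
  | peek {k v s} : Exec (.peek k) v s 1 ⟨v.sym, (s.get k).head?, v.flag⟩ s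
  | read {v s} : Exec .read v s 1 ⟨s.inp.head?, v.bit, v.flag⟩
      ⟨s.inp.tail, s.out, s.main, s.rev, s.aux, s.cnt⟩
  | write {f v s} : Exec (.write f) v s 1 v ⟨s.inp, f v :: s.out, s.main, s.rev, s.aux, s.cnt⟩
  | load {f v s} : Exec (.load f) v s 1 (f v) s
  | seq {p q v s t v' s' t' v'' s''} : Exec p v s t v' s' → Exec q v' s' t' v'' s'' →
      Exec (p ;; q) v s (t + t') v'' s''
  | iteTrue {b p q v s t v' s'} : b v = true → Exec p v s t v' s' →
      Exec (.ite b p q) v s (t + 1) v' s'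
  | iteFalse {b p q v s t v' s'} : b v = false → Exec q v s t v' s' →
      Exec (.ite b p q) v s (t + 1) v' s'
  | loopFalse {b p v s} : b v = false → Exec (.loop b p) v s 1 v s
  | loopTrue {b p v s t v' s' t' v'' s''} : b v = true → Exec p v s t v' s' →
      Exec (.loop b p) v' s' t' v'' s'' → Exec (.loop b p) v s (t + 1 + t') v'' s''

namespace Prog

/-- The labels of the machine that executes a program: one label for each node of its syntax
tree, except for the sequential compositions. -/
def Lab : Prog → Type
  | push _ _ | pop _ | peek _ | read | write _ | load _ => Unit
  | seq p q => p.Lab ⊕ q.Lab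
  | ite _ p q => Option (p.Lab ⊕ q.Lab)
  | loop _ p => Option p.Lab

theorem finite_lab : ∀ p : Prog, Finite p.Lab
  | push _ _ | pop _ | peek _ | read | write _ | load _ => inferInstanceAs (Finite Unit)
  | seq p q =>
    have := finite_lab p
    have := finite_lab q
    inferInstanceAs (Finite (p.Lab ⊕ q.Lab))
  | ite _ p q =>
    have := finite_lab p
    have := finite_lab q
    inferInstanceAs (Finite (Option (p.Lab ⊕ q.Lab)))
  | loop _ p =>
    have := finite_lab p
    inferInstanceAs (Finite (Option p.Lab))

/-- The label at which the execution of a program starts. -/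
def entry : ∀ p : Prog, p.Lab
  | push _ _ | pop _ | peek _ | read | write _ | load _ => ()
  | seq p _ => Sum.inl p.entry
  | ite _ _ _ | loop _ _ => none

/-- Statements of machines with label type `Λ`. -/
abbrev MStmt (Λ : Type) := Turing.TM2.Stmt Alph Λ Reg

/-- The statement at each label of a program. The labels are embedded into `Λ` by `ι`, and control
passes to `ex` when the program is finished. -/
def stmt {Λ : Type} : ∀ p : Prog, (p.Lab → Λ) → MStmt Λ → p.Lab → MStmt Λ
  | push k f, _, ex, _ => .push (.work k) f ex
  | pop k, _, ex, _ => .pop (.work k) (fun v x => ⟨v.sym, x, v.flag⟩) ex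
  | peek k, _, ex, _ => .peek (.work k) (fun v x => ⟨v.sym, x, v.flag⟩) ex
  | read, _, ex, _ => .pop .inp (fun v x => ⟨x, v.bit, v.flag⟩) ex
  | write f, _, ex, _ => .push .out f ex
  | load f, _, ex, _ => .load f ex
  | seq p q, ι, _, .inl l => p.stmt (fun l => ι (.inl l)) (.goto fun _ => ι (.inr q.entry)) l
  | seq _ q, ι, ex, .inr l => q.stmt (fun l => ι (.inr l)) ex l
  | ite b p q, ι, _, none => .branch b (.goto fun _ => ι (some (.inl p.entry)))
      (.goto fun _ => ι (some (.inr q.entry)))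
  | ite _ p _, ι, ex, some (.inl l) => p.stmt (fun l => ι (some (.inl l))) ex l
  | ite _ _ q, ι, ex, some (.inr l) => q.stmt (fun l => ι (some (.inr l))) ex l
  | loop b p, ι, ex, none => .branch b (.goto fun _ => ι (some p.entry)) ex
  | loop _ p, ι, _, some l => p.stmt (fun l => ι (some l)) (.goto fun _ => ι none) l

/-- Configurations of machines with label type `Λ`. -/
abbrev MCfg (Λ : Type) := Turing.TM2.Cfg Alph Λ Reg

theorem iterate_bind_trans {Λ : Type} {f : MCfg Λ → Option (MCfg Λ)} {a b c : Option (MCfg Λ)}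
    {t t' : ℕ} (h : (flip bind f)^[t] a = b) (h' : (flip bind f)^[t'] b = c) :
    (flip bind f)^[t + t'] a = c := by
  rw [Nat.add_comm, Function.iterate_add_apply, h, h']

/-- The translation to machines is correct: execution of a program takes the machine from the entry
label to the exit statement, in the same number of steps. -/
theorem iterate_step_of_exec {p : Prog} {v s t v' s'} (h : Exec p v s t v' s') {Λ : Type}
    (M : Λ → MStmt Λ) (ι : p.Lab → Λ) (ex : MStmt Λ) (hM : ∀ l, M (ι l) = p.stmt ι ex l) :
    (flip bind (Turing.TM2.step M))^[t] (some ⟨some (ι p.entry), v, s.stk⟩) =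
      some (Turing.TM2.stepAux ex v' s'.stk) := by
  induction h generalizing ex with
  | push =>
    refine congrArg some ?_
    rw [hM, ← Mem.update_work]
    rfl
  | pop =>
    refine congrArg some ?_
    rw [hM, ← Mem.update_work]
    rfl
  | peek =>
    refine congrArg some ?_
    rw [hM]
    rfl
  | read =>
    refine congrArg some ?_
    rw [hM]
    exact congrArg (Turing.TM2.stepAux ex _) (Mem.update_inp _ _)
  | write =>
    refine congrArg some ?_
    rw [hM]
    exact congrArg (Turing.TM2.stepAux ex _) (Mem.update_out _ _)
  | load =>
    refine congrArg some ?_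
    rw [hM]
    rfl
  | @seq p q v s t v' s' t' v'' s'' _ _ ih₁ ih₂ =>
    exact iterate_bind_trans (ih₁ (fun l => ι (.inl l)) _ fun l => hM (.inl l))
      (ih₂ (fun l => ι (.inr l)) ex fun l => hM (.inr l))
  | @iteTrue b p q v s t v' s' hb _ ih =>
    rw [Nat.add_comm]
    refine iterate_bind_trans (t := 1) (b := some ⟨some (ι (some (.inl p.entry))), v, s.stk⟩)
      ?_ (ih (fun l => ι (some (.inl l))) ex fun l => hM (some (.inl l)))
    refine congrArg some ?_
    rw [hM]
    simp [stmt, entry, hb]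
  | @iteFalse b p q v s t v' s' hb _ ih =>
    rw [Nat.add_comm]
    refine iterate_bind_trans (t := 1) (b := some ⟨some (ι (some (.inr q.entry))), v, s.stk⟩)
      ?_ (ih (fun l => ι (some (.inr l))) ex fun l => hM (some (.inr l)))
    refine congrArg some ?_
    rw [hM]
    simp [stmt, entry, hb]
  | loopFalse hb =>
    refine congrArg some ?_
    rw [hM]
    simp [stmt, entry, hb]
  | @loopTrue b p v s t v' s' t' v'' s'' hb _ _ ih₁ ih₂ =>
    refine iterate_bind_trans ?_ (ih₂ ι ex hM)
    rw [Nat.add_comm]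
    refine iterate_bind_trans (t := 1) (b := some ⟨some (ι (some p.entry)), v, s.stk⟩)
      ?_ (ih₁ (fun l => ι (some l)) (.goto fun _ => ι none) fun l => hM (some l))
    refine congrArg some ?_
    rw [hM]
    simp [stmt, entry, hb]

/-- The machine that executes a program. -/
noncomputable def machine (p : Prog) : Turing.FinTM2 :=
  have := p.finite_lab
  { K := Stack
    k₀ := .inp
    k₁ := .out
    Γ := Alph
    Λ := p.Lab
    main := p.entry
    ΛFin := Fintype.ofFinite _
    σ := Reg
    initialState := ⟨none, none, none⟩
    Γk₀Fin := inferInstanceAs (Fintype Symbol)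
    m := p.stmt id (.load (fun _ => ⟨none, none, none⟩) .halt) }

end Prog

/-- A program that turns the input `x` into the output `F x` and leaves all work stacks empty
witnesses that `F` is computable within the same time. -/
theorem computableWithin_of_exec {α : Type} {enc : α → List Symbol} {F t : α → ℕ} (p : Prog)
    (h : ∀ x, ∃ t' ≤ t x, ∃ v', Exec p ⟨none, none, none⟩ ⟨enc x, [], [], [], [], []⟩ t' v'
      ⟨[], Computability.encodeNat (F x), [], [], [], []⟩) :
    ComputableWithin enc F t := by
  refine ⟨⟨p.machine, Equiv.refl _, Equiv.refl _⟩, fun s => ?_, fun x => ?_⟩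
  · rcases s with _ | _ | w
    exacts [inferInstanceAs (Finite Symbol), inferInstanceAs (Finite Bool),
      inferInstanceAs (Finite Bool)]
  · obtain ⟨t', ht', v', hx⟩ := h x
    have key := Prog.iterate_step_of_exec hx (p.stmt id _) id
      (.load (fun _ => ⟨none, none, none⟩) .halt) fun _ => rfl
    refine ⟨⟨⟨t', ?_⟩, ht'⟩⟩
    have h₁ : Turing.initList p.machine ((enc x).map (Equiv.refl Symbol).symm) =
        ⟨some p.entry, ⟨none, none, none⟩, (⟨enc x, [], [], [], [], []⟩ : Mem).stk⟩ := by
      unfold Turing.initList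
      congr 1
      funext k
      rcases k with _ | _ | w
      · exact List.map_id _
      · rfl
      · cases w <;> rfl
    have h₂ : Turing.haltList p.machine
        ((Computability.encodeNat (F x)).map (Equiv.refl Bool).symm) =
        ⟨none, ⟨none, none, none⟩,
          (⟨[], Computability.encodeNat (F x), [], [], [], []⟩ : Mem).stk⟩ := by
      unfold Turing.haltList
      congr 1
      funext k
      rcases k with _ | _ | w
      · rfl
      · exact List.map_id _
      · cases w <;> rfl
    change (flip bind (Turing.TM2.step _))^[t'] (some (Turing.initList p.machine
        ((enc x).map (Equiv.refl Symbol).symm))) = some (Turing.haltList p.machine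
        ((Computability.encodeNat (F x)).map (Equiv.refl Bool).symm))
    rw [h₁, h₂]
    exact key

/-! ### Binary trees on the main stack -/

/-- Binary trees, the universal data type of the programs. -/
inductive Data
  | nil
  | node (a b : Data)

namespace Data

/-- The prefix code of a tree. Prefix codes are self-delimiting, so a sequence of trees is stored on
a stack as the concatenation of their codes. -/
def word : Data → List Bool
  | nil => [false]
  | node a b => true :: (a.word ++ b.word)

/-- The first component of a pair. -/
def fst : Data → Data
  | nil => nil
  | node a _ => a

/-- The second component of a pair. -/
def snd : Data → Data
  | nil => nil
  | node _ b => b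

/-- The truth values as trees. -/
def ofBool : Bool → Data
  | false => nil
  | true => node nil nil

theorem word_append_injective : ∀ {a b : Data} {r s : List Bool},
    a.word ++ r = b.word ++ s → a = b ∧ r = s
  | nil, nil, _, _, h => ⟨rfl, by simpa [word] using h⟩
  | nil, node _ _, _, _, h => by simp [word] at h
  | node _ _, nil, _, _, h => by simp [word] at h
  | node a b, node a' b', r, s, h => by
    simp only [word, List.cons_append, List.append_assoc, List.cons.injEq, true_and] at h
    obtain ⟨ha, h⟩ := word_append_injective h
    obtain ⟨hb, h⟩ := word_append_injective h
    exact ⟨by rw [ha, hb], h⟩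

theorem word_injective : Function.Injective word := fun a b h =>
  (word_append_injective (r := []) (s := []) (by rw [h])).1

theorem one_le_length_word : ∀ a : Data, 1 ≤ a.word.length
  | nil => le_rfl
  | node _ _ => by simp [word]

theorem length_word_fst_le : ∀ a : Data, a.fst.word.length ≤ a.word.length
  | nil => le_rfl
  | node _ _ => by simp [word, fst]; omega

theorem length_word_snd_le : ∀ a : Data, a.snd.word.length ≤ a.word.length
  | nil => le_rfl
  | node _ _ => by simp [word, snd]; omega

end Data

namespace Prog

/-- One of the two auxiliary stacks. -/
def side : Bool → Work
  | true => .rev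
  | false => .aux

/-- Stack contents, described relative to one of the two auxiliary stacks: the main stack, the
given auxiliary stack, the other one, and the counter. -/
def sideMem : Bool → List Bool → List Bool → List Bool → List Bool → Mem
  | true, w, l, o, c => ⟨[], [], w, l, o, c⟩
  | false, w, l, o, c => ⟨[], [], w, o, l, c⟩

/-- The loop of `move`. -/
def moveLoop (b : Bool) : Prog :=
  .loop (fun v => v.bit.isSome) <|
    .pop .main ;; .push (side b) (fun v => v.bit.getD false) ;;
      .ite (fun v => v.bit.getD false) (.push .cnt fun _ => true) (.pop .cnt) ;; .peek .cnt

/-- Move a tree from the main stack to an auxiliary stack, which reverses its code. The counter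
holds the number of trees that remain to be read. -/
def move (b : Bool) : Prog := .push .cnt (fun _ => true) ;; .peek .cnt ;; moveLoop b

theorem exec_moveLoop (b : Bool) (o : List Bool) (a : Data) :
    ∀ {sy fl w l c n v' s'},
      Exec (moveLoop b) ⟨sy, c.head?, fl⟩ (sideMem b w (a.word.reverse ++ l) o c) n v' s' →
      Exec (moveLoop b) ⟨sy, some true, fl⟩ (sideMem b (a.word ++ w) l o (true :: c))
        (6 * a.word.length + n) v' s' := by
  induction a with
  | nil =>
    intro sy fl w l c n v' s' h
    cases b
    · exact .loopTrue rfl (.seq .pop (.seq .push (.seq (.iteFalse rfl .pop) .peek))) h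
    · exact .loopTrue rfl (.seq .pop (.seq .push (.seq (.iteFalse rfl .pop) .peek))) h
  | node x y ihx ihy =>
    intro sy fl w l c n v' s' h
    have h₁ : Exec (moveLoop b) ⟨sy, some true, fl⟩
        (sideMem b (x.word ++ (y.word ++ w)) (true :: l) o (true :: true :: c))
        (6 * x.word.length + (6 * y.word.length + n)) v' s' := by
      refine ihx (c := true :: c) (ihy ?_)
      simpa [Data.word] using h
    have h₂ : 6 * (Data.node x y).word.length + n =
        6 + (6 * x.word.length + (6 * y.word.length + n)) := by
      simp [Data.word]; ring
    have h₃ : (Data.node x y).word ++ w = true :: (x.word ++ (y.word ++ w)) := by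
      simp [Data.word]
    rw [h₂, h₃]
    cases b
    · exact .loopTrue rfl (.seq .pop (.seq .push (.seq (.iteTrue rfl .push) .peek))) h₁
    · exact .loopTrue rfl (.seq .pop (.seq .push (.seq (.iteTrue rfl .push) .peek))) h₁

theorem exec_move (b : Bool) (a : Data) (v w l o) :
    ∃ v', Exec (move b) v (sideMem b (a.word ++ w) l o []) (6 * a.word.length + 3) v'
      (sideMem b w (a.word.reverse ++ l) o []) := by
  refine ⟨⟨v.sym, none, v.flag⟩, ?_⟩
  rw [show 6 * a.word.length + 3 = 1 + (1 + (6 * a.word.length + 1)) by ring]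
  have h := exec_moveLoop b o a (sy := v.sym) (fl := v.flag) (w := w) (l := l) (c := [])
    (.loopFalse rfl)
  cases b
  · exact .seq .push (.seq .peek h)
  · exact .seq .push (.seq .peek h)

/-- Empty the stack `k`, executing `p` for each bit that is popped. -/
def drain (k : Work) (p : Prog) : Prog :=
  .pop k ;; .loop (fun v => v.bit.isSome) (p ;; .pop k)

/-- The general rule for `drain`: `S l d` is the memory when `l` is still to be drained and `d` has
been processed. -/
theorem exec_drain {k : Work} {p : Prog} {c : ℕ} (S : List Bool → List Bool → Mem)
    (hget : ∀ l d, (S l d).get k = l) (l d : List Bool)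
    (hp : ∀ v b l d, v.bit = some b →
      ∃ v', Exec p v ((S (b :: l) d).set k l) c v' (S l (b :: d)))
    (hnil : ∀ d, (S [] d).set k [] = S [] d) (v : Reg) :
    ∃ v', Exec (drain k p) v (S l d) ((c + 2) * l.length + 2) v' (S [] (l.reverse ++ d)) := by
  have key : ∀ l d (v : Reg), v.bit = l.head? → ∃ v',
      Exec (.loop (fun v => v.bit.isSome) (p ;; .pop k)) v ((S l d).set k l.tail)
        ((c + 2) * l.length + 1) v' (S [] (l.reverse ++ d)) := by
    intro l
    induction l with
    | nil =>
      intro d v hv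
      rw [List.tail_nil, hnil]
      exact ⟨v, .loopFalse (by simp [hv])⟩
    | cons b l ih =>
      intro d v hv
      obtain ⟨v₁, h₁⟩ := hp v b l d hv
      obtain ⟨v₂, h₂⟩ := ih (b :: d) ⟨v₁.sym, l.head?, v₁.flag⟩ rfl
      refine ⟨v₂, ?_⟩
      have h₃ : Exec (.pop k) v₁ (S l (b :: d)) 1 ⟨v₁.sym, l.head?, v₁.flag⟩
          ((S l (b :: d)).set k l.tail) := by
        have := @Exec.pop k v₁ (S l (b :: d))
        rwa [hget] at this
      have h₄ := Exec.loopTrue (b := fun v => v.bit.isSome) (by simp [hv]) (.seq h₁ h₃) h₂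
      have e : (c + 2) * (b :: l).length + 1 = c + 1 + 1 + ((c + 2) * l.length + 1) := by
        simp; ring
      rw [e, List.reverse_cons, List.append_assoc]
      exact h₄
  obtain ⟨v', h⟩ := key l d ⟨v.sym, l.head?, v.flag⟩ rfl
  refine ⟨v', ?_⟩
  have h₁ := @Exec.pop k v (S l d)
  rw [hget] at h₁
  rw [show (c + 2) * l.length + 2 = 1 + ((c + 2) * l.length + 1) by omega]
  exact Exec.seq h₁ h

/-- Specification of programs that act on the main stack: `p` turns the contents `w` into `w'` in
at most `T` steps. -/
def Does (p : Prog) (w w' : List Bool) (T : ℕ) : Prop :=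
  ∀ v, ∃ v' t, t ≤ T ∧ Exec p v ⟨[], [], w, [], [], []⟩ t v' ⟨[], [], w', [], [], []⟩

theorem Does.seq {p q : Prog} {w w' w'' : List Bool} {T T' : ℕ} (hp : Does p w w' T)
    (hq : Does q w' w'' T') : Does (p ;; q) w w'' (T + T') := by
  intro v
  obtain ⟨v₁, t₁, ht₁, h₁⟩ := hp v
  obtain ⟨v₂, t₂, ht₂, h₂⟩ := hq v₁
  exact ⟨v₂, t₁ + t₂, by omega, .seq h₁ h₂⟩

theorem Does.mono {p : Prog} {w w' : List Bool} {T T' : ℕ} (hp : Does p w w' T) (h : T ≤ T') :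
    Does p w w' T' := fun v =>
  let ⟨v₁, t₁, ht₁, h₁⟩ := hp v
  ⟨v₁, t₁, ht₁.trans h, h₁⟩

/-- The program that does nothing. -/
def skip : Prog := .load id

theorem does_skip (w : List Bool) : Does skip w w 1 := fun v => ⟨v, 1, le_rfl, .load⟩

/-- Push a fixed word to the main stack. -/
def pushWord : List Bool → Prog
  | [] => skip
  | b :: l => pushWord l ;; .push .main fun _ => b

theorem does_pushWord (u w : List Bool) : Does (pushWord u) w (u ++ w) (u.length + 1) := by
  induction u with
  | nil => exact does_skip w
  | cons b u ih =>
    exact ih.seq (T' := 1) fun v => ⟨v, 1, le_rfl, .push⟩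

/-- Pop a bit from the main stack and branch according to its value. -/
def popIte (p q : Prog) : Prog := .pop .main ;; .ite (fun v => v.bit.getD false) p q

theorem does_popIte_true {p q : Prog} {w w' : List Bool} {T : ℕ} (h : Does p w w' T) :
    Does (popIte p q) (true :: w) w' (T + 2) := by
  intro v
  obtain ⟨v₁, t₁, ht₁, h₁⟩ := h ⟨v.sym, some true, v.flag⟩
  exact ⟨v₁, 1 + (t₁ + 1), by omega, .seq .pop (.iteTrue rfl h₁)⟩

theorem does_popIte_false {p q : Prog} {w w' : List Bool} {T : ℕ} (h : Does q w w' T) :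
    Does (popIte p q) (false :: w) w' (T + 2) := by
  intro v
  obtain ⟨v₁, t₁, ht₁, h₁⟩ := h ⟨v.sym, some false, v.flag⟩
  exact ⟨v₁, 1 + (t₁ + 1), by omega, .seq .pop (.iteFalse rfl h₁)⟩

/-- Remove the topmost tree. -/
def drop : Prog := move true ;; drain .rev skip

theorem does_drop (a : Data) (w : List Bool) :
    Does drop (a.word ++ w) w (9 * a.word.length + 5) := by
  intro v
  obtain ⟨v₁, h₁⟩ := exec_move true a v w [] []
  obtain ⟨v₂, h₂⟩ := exec_drain (k := .rev) (p := skip) (c := 1)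
    (fun l _ => ⟨[], [], w, l, [], []⟩) (fun _ _ => rfl) (a.word.reverse ++ []) []
    (fun v _ _ _ _ => ⟨v, .load⟩) (fun _ => rfl) v₁
  exact ⟨v₂, _, by simp; omega, .seq h₁ h₂⟩

/-- Move the reversed contents of a work stack to another one. -/
def transfer (k k' : Work) : Prog := drain k (.push k' fun v => v.bit.getD false)

/-- Duplicate the topmost tree. -/
def dup : Prog :=
  move true ;; drain .rev (.push .main (fun v => v.bit.getD false) ;;
    .push .aux fun v => v.bit.getD false) ;; transfer .aux .rev ;; transfer .rev .main

theorem does_dup (a : Data) (w : List Bool) :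
    Does dup (a.word ++ w) (a.word ++ (a.word ++ w)) (16 * a.word.length + 9) := by
  intro v
  obtain ⟨v₁, h₁⟩ := exec_move true a v w [] []
  rw [List.append_nil] at h₁
  obtain ⟨v₂, h₂⟩ := exec_drain (k := .rev) (c := 2)
    (p := .push .main (fun v => v.bit.getD false) ;; .push .aux fun v => v.bit.getD false)
    (fun l d => ⟨[], [], d ++ w, l, d, []⟩) (fun _ _ => rfl) a.word.reverse []
    (fun v b l d hv => ⟨v, by
      have h : v.bit.getD false = b := by simp [hv]
      have := Exec.seq (@Exec.push .main (fun v => v.bit.getD false) v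
        ⟨[], [], d ++ w, l, d, []⟩) (@Exec.push .aux (fun v => v.bit.getD false) v _)
      simp only [h] at this
      exact this⟩) (fun _ => rfl) v₁
  rw [List.reverse_reverse, List.append_nil] at h₂
  obtain ⟨v₃, h₃⟩ := exec_drain (k := .aux) (c := 1)
    (p := .push .rev fun v => v.bit.getD false)
    (fun l d => ⟨[], [], a.word ++ w, d, l, []⟩) (fun _ _ => rfl) a.word []
    (fun v b l d hv => ⟨v, by
      have := @Exec.push .rev (fun v => v.bit.getD false) v ⟨[], [], a.word ++ w, d, l, []⟩
      simp only [hv] at this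
      exact this⟩) (fun _ => rfl) v₂
  rw [List.append_nil] at h₃
  obtain ⟨v₄, h₄⟩ := exec_drain (k := .rev) (c := 1)
    (p := .push .main fun v => v.bit.getD false)
    (fun l d => ⟨[], [], d ++ (a.word ++ w), l, [], []⟩) (fun _ _ => rfl) a.word.reverse []
    (fun v b l d hv => ⟨v, by
      have := @Exec.push .main (fun v => v.bit.getD false) v
        ⟨[], [], d ++ (a.word ++ w), l, [], []⟩
      simp only [hv] at this
      exact this⟩) (fun _ => rfl) v₃
  rw [List.reverse_reverse, List.append_nil] at h₄
  exact ⟨v₄, _, by simp; omega, .seq h₁ (.seq h₂ (.seq h₃ h₄))⟩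

/-- Exchange the two topmost trees. -/
def swap : Prog := move true ;; move false ;; transfer .rev .main ;; transfer .aux .main

theorem does_swap (a b : Data) (w : List Bool) :
    Does swap (a.word ++ (b.word ++ w)) (b.word ++ (a.word ++ w))
      (9 * a.word.length + 9 * b.word.length + 10) := by
  intro v
  obtain ⟨v₁, h₁⟩ := exec_move true a v (b.word ++ w) [] []
  obtain ⟨v₂, h₂⟩ := exec_move false b v₁ w [] (a.word.reverse)
  rw [List.append_nil] at h₁ h₂
  obtain ⟨v₃, h₃⟩ := exec_drain (k := .rev) (c := 1)
    (p := .push .main fun v => v.bit.getD false)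
    (fun l d => ⟨[], [], d ++ w, l, b.word.reverse, []⟩) (fun _ _ => rfl) a.word.reverse []
    (fun v x l d hv => ⟨v, by
      have := @Exec.push .main (fun v => v.bit.getD false) v
        ⟨[], [], d ++ w, l, b.word.reverse, []⟩
      simp only [hv] at this
      exact this⟩) (fun _ => rfl) v₂
  rw [List.reverse_reverse, List.append_nil] at h₃
  obtain ⟨v₄, h₄⟩ := exec_drain (k := .aux) (c := 1)
    (p := .push .main fun v => v.bit.getD false)
    (fun l d => ⟨[], [], d ++ (a.word ++ w), [], l, []⟩) (fun _ _ => rfl) b.word.reverse []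
    (fun v x l d hv => ⟨v, by
      have := @Exec.push .main (fun v => v.bit.getD false) v
        ⟨[], [], d ++ (a.word ++ w), [], l, []⟩
      simp only [hv] at this
      exact this⟩) (fun _ => rfl) v₃
  rw [List.reverse_reverse, List.append_nil] at h₄
  exact ⟨v₄, _, by simp; omega, .seq h₁ (.seq h₂ (.seq h₃ h₄))⟩

/-- Compare the two auxiliary stacks bit by bit, and push a bit to the counter for each
difference. -/
def compare : Prog :=
  .loop (fun v => v.bit.isSome || v.flag.isSome) <|
    .pop .rev ;; .load (fun v => ⟨v.sym, v.bit, v.bit⟩) ;; .pop .aux ;;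
      .ite (fun v => decide (v.bit = v.flag)) skip (.push .cnt fun _ => true)

/-- The final counter `c'` is empty exactly if `c` is empty and the two words agree. The bits read
last, `v.bit` and `v.flag`, keep the loop running until both stacks are exhausted. -/
theorem exec_compare (w : List Bool) : ∀ (la lb c : List Bool) (v : Reg),
    (v.bit.isSome || v.flag.isSome) = true → ∃ c' v' n,
      n ≤ 6 * (la.length + lb.length) + 7 ∧ (c' = [] ↔ c = [] ∧ la = lb) ∧
      c'.length ≤ c.length + la.length + lb.length ∧
      Exec compare v ⟨[], [], w, la, lb, c⟩ n v' ⟨[], [], w, [], [], c'⟩ := by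
  have step : ∀ (la lb c : List Bool) (v : Reg), ∃ n ≤ 5,
      Exec (.pop .rev ;; .load (fun v => ⟨v.sym, v.bit, v.bit⟩) ;; .pop .aux ;;
        .ite (fun v => decide (v.bit = v.flag)) skip (.push .cnt fun _ => true)) v
        ⟨[], [], w, la, lb, c⟩ n ⟨v.sym, lb.head?, la.head?⟩
        ⟨[], [], w, la.tail, lb.tail, if lb.head? = la.head? then c else true :: c⟩ := by
    intro la lb c v
    split_ifs with h
    · exact ⟨_, by norm_num, .seq .pop (.seq .load (.seq .pop (.iteTrue (decide_eq_true h) .load)))⟩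
    · exact ⟨_, by norm_num,
        .seq .pop (.seq .load (.seq .pop (.iteFalse (decide_eq_false h) .push)))⟩
  have both : ∀ (c : List Bool) (v : Reg), (v.bit.isSome || v.flag.isSome) = true → ∃ v' n, n ≤ 7 ∧
      Exec compare v ⟨[], [], w, [], [], c⟩ n v' ⟨[], [], w, [], [], c⟩ := by
    intro c v hv
    obtain ⟨n, hn, h⟩ := step [] [] c v
    exact ⟨_, _, by omega, .loopTrue hv h (.loopFalse rfl)⟩
  intro la
  induction la with
  | nil =>
    intro lb
    induction lb with
    | nil =>
      intro c v hv
      obtain ⟨v', n, hn, h⟩ := both c v hv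
      exact ⟨c, v', n, by simpa using hn, by simp, by simp, h⟩
    | cons y lb ih =>
      intro c v hv
      obtain ⟨n, hn, h⟩ := step [] (y :: lb) c v
      obtain ⟨c', v', n', hn', hc', hl, h'⟩ := ih (true :: c) ⟨v.sym, some y, none⟩ rfl
      refine ⟨c', v', _, ?_, ?_, ?_, .loopTrue hv h h'⟩
      · simp at hn' ⊢; omega
      · simp at hc' ⊢; exact hc'
      · simp at hl ⊢; omega
  | cons x la ih =>
    intro lb c v hv
    obtain ⟨n, hn, h⟩ := step (x :: la) lb c v
    obtain ⟨c', v', n', hn', hc', hl, h'⟩ :=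
      ih lb.tail (if lb.head? = some x then c else true :: c) ⟨v.sym, lb.head?, some x⟩ (by simp)
    refine ⟨c', v', _, ?_, ?_, ?_, .loopTrue hv h h'⟩
    · simp at hn' ⊢; omega
    · rw [hc']
      rcases lb with _ | ⟨y, lb⟩
      · simp
      · by_cases hxy : y = x
        · subst hxy; simp
        · simp [hxy, Ne.symm hxy]
    · refine hl.trans ?_
      rcases lb with _ | ⟨y, lb⟩
      · simp; omega
      · by_cases hxy : y = x
        · subst hxy; simp; omega
        · simp [hxy]; omega

/-- Replace the two topmost trees by the truth value of their equality. -/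
def equal : Prog :=
  move true ;; move false ;; .load (fun v => ⟨v.sym, some true, v.flag⟩) ;; compare ;;
    .peek .cnt ;; .ite (fun v => v.bit.isSome) (pushWord (Data.ofBool false).word)
      (pushWord (Data.ofBool true).word) ;; drain .cnt skip

open Classical in
theorem does_equal (a b : Data) (w : List Bool) :
    Does equal (a.word ++ (b.word ++ w)) ((Data.ofBool (decide (a = b))).word ++ w)
      (20 * a.word.length + 20 * b.word.length + 40) := by
  intro v
  obtain ⟨v₁, h₁⟩ := exec_move true a v (b.word ++ w) [] []
  obtain ⟨v₂, h₂⟩ := exec_move false b v₁ w [] (a.word.reverse)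
  rw [List.append_nil] at h₁ h₂
  obtain ⟨c, v₃, n₃, hn₃, hc, hcl, h₃⟩ := exec_compare w a.word.reverse b.word.reverse []
    ⟨v₂.sym, some true, v₂.flag⟩ rfl
  obtain ⟨v₄, n₄, hn₄, h₄⟩ : ∃ v' n, n ≤ 5 ∧ Exec (.ite (fun v => v.bit.isSome)
      (pushWord (Data.ofBool false).word) (pushWord (Data.ofBool true).word))
      ⟨v₃.sym, c.head?, v₃.flag⟩ ⟨[], [], w, [], [], c⟩ n v'
      ⟨[], [], (Data.ofBool (decide (a = b))).word ++ w, [], [], c⟩ := by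
    have hab : c = [] ↔ a = b := by simp [hc, Data.word_injective.eq_iff]
    rcases c with _ | ⟨x, c⟩
    · have : a = b := hab.1 rfl
      refine ⟨⟨v₃.sym, none, v₃.flag⟩, _, le_rfl, .iteFalse (t := 4) rfl ?_⟩
      simp only [this, decide_true]
      exact .seq (.seq (.seq .load .push) .push) .push
    · have : a ≠ b := fun h => by simpa using hab.2 h
      refine ⟨⟨v₃.sym, some x, v₃.flag⟩, _, by norm_num, .iteTrue (t := 2) rfl ?_⟩
      simp only [this, decide_false]
      exact .seq .load .push
  obtain ⟨v₅, h₅⟩ := exec_drain (k := .cnt) (p := skip) (c := 1)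
    (fun l _ => ⟨[], [], (Data.ofBool (decide (a = b))).word ++ w, [], [], l⟩)
    (fun _ _ => rfl) c [] (fun v _ _ _ _ => ⟨v, .load⟩) (fun _ => rfl) v₄
  refine ⟨v₅, _, ?_, .seq h₁ (.seq h₂ (.seq .load (.seq h₃ (.seq .peek (.seq h₄ h₅)))))⟩
  simp at hn₃ hcl ⊢
  omega

/-- Test whether the first component of the topmost tree is `Data.nil`. -/
def testFst : Prog := .pop .main ;; .peek .main ;; .push .main fun _ => true

/-- Repeat `p` as long as the first component of the topmost tree is not `Data.nil`. -/
def whileFst (p : Prog) : Prog :=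
  testFst ;; .loop (fun v => v.bit.getD false) (p ;; testFst)

theorem does_whileFst {p : Prog} {r : List Bool} {T n : ℕ} (a b : ℕ → Data)
    (ha : ∀ i < n, a i ≠ .nil) (hn : a n = .nil)
    (hp : ∀ i < n, Does p ((Data.node (a i) (b i)).word ++ r)
      ((Data.node (a (i + 1)) (b (i + 1))).word ++ r) T) :
    Does (whileFst p) ((Data.node (a 0) (b 0)).word ++ r) ((Data.node (a n) (b n)).word ++ r)
      ((T + 4) * n + 4) := by
  have test : ∀ (x y : Data) (v : Reg), Exec testFst v
      ⟨[], [], (Data.node x y).word ++ r, [], [], []⟩ 3 ⟨v.sym, x.word.head?, v.flag⟩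
      ⟨[], [], (Data.node x y).word ++ r, [], [], []⟩ := by
    intro x y v
    cases x
    · exact .seq .pop (.seq .peek .push)
    · exact .seq .pop (.seq .peek .push)
  have key : ∀ k i (v : Reg), i + k = n → v.bit = (a i).word.head? → ∃ v' t,
      t ≤ (T + 4) * k + 1 ∧ Exec (.loop (fun v => v.bit.getD false) (p ;; testFst)) v
        ⟨[], [], (Data.node (a i) (b i)).word ++ r, [], [], []⟩ t v'
        ⟨[], [], (Data.node (a n) (b n)).word ++ r, [], [], []⟩ := by
    intro k
    induction k with
    | zero =>
      intro i v hi hv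
      obtain rfl : i = n := by omega
      exact ⟨v, 1, by simp, .loopFalse (by simp [hv, hn, Data.word])⟩
    | succ k ih =>
      intro i v hi hv
      obtain ⟨v₁, t₁, ht₁, h₁⟩ := hp i (by omega) v
      obtain ⟨v₂, t₂, ht₂, h₂⟩ := ih (i + 1) ⟨v₁.sym, (a (i + 1)).word.head?, v₁.flag⟩
        (by omega) rfl
      refine ⟨v₂, _, ?_, .loopTrue ?_ (.seq h₁ (test _ _ v₁)) h₂⟩
      · rw [Nat.mul_succ]; omega
      · have := ha i (by omega)
        rcases h : a i with _ | ⟨x, y⟩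
        · exact absurd h this
        · simp [hv, h, Data.word]
  intro v
  obtain ⟨v', t, ht, h⟩ := key n 0 ⟨v.sym, (a 0).word.head?, v.flag⟩ (by omega) rfl
  exact ⟨v', _, by omega, .seq (test _ _ v) h⟩

end Prog

/-! ### Encoding by trees, input and output -/

/-- A list of trees as a tree. -/
def Data.ofList : List Data → Data
  | [] => .nil
  | a :: l => .node a (Data.ofList l)

/-- The tree of an input symbol. All these trees have codes of the same length. -/
def Symbol.toData : Symbol → Data
  | .bit false => .node (.node (.node .nil .nil) .nil) .nil
  | .bit true => .node (.node .nil (.node .nil .nil)) .nil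
  | .minus => .node (.node .nil .nil) (.node .nil .nil)
  | .comma => .node .nil (.node (.node .nil .nil) .nil)

/-- Representation of the elements of a type by trees. -/
class Code (α : Type) where
  /-- the tree that represents an element -/
  code : α → Data

open Code (code)

instance : Code Data := ⟨id⟩
instance : Code Unit := ⟨fun _ => .nil⟩
instance : Code Bool := ⟨Data.ofBool⟩
instance : Code Symbol := ⟨Symbol.toData⟩
instance {α β : Type} [Code α] [Code β] : Code (α × β) := ⟨fun x => .node (code x.1) (code x.2)⟩
instance {α : Type} [Code α] : Code (List α) := ⟨fun l => Data.ofList (l.map code)⟩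
instance : Code ℕ := ⟨fun n => code (Computability.encodeNat n)⟩
instance : Code ℤ := ⟨fun z => code (decide (z < 0), Computability.encodeNat z.natAbs)⟩
/-- An instance is represented by the reversed input string. -/
instance : Code Instance := ⟨fun I => code I.encode.reverse⟩

/-- The length of the code of an element. -/
def size {α : Type} [Code α] (x : α) : ℕ := (code x).word.length

section

variable {α β : Type} [Code α] [Code β]

theorem one_le_size (x : α) : 1 ≤ size x := Data.one_le_length_word _

@[simp] theorem size_unit (x : Unit) : size x = 1 := rfl

theorem size_bool_le (b : Bool) : size b ≤ 3 := by
  cases b <;> simp [size, code, Data.ofBool, Data.word]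

@[simp] theorem size_pair (x : α) (y : β) : size (x, y) = size x + size y + 1 := by
  simp [size, code, Data.word]

@[simp] theorem size_nil : size ([] : List α) = 1 := rfl

@[simp] theorem size_cons (a : α) (l : List α) : size (a :: l) = size a + size l + 1 := by
  simp [size, code, Data.word, Data.ofList]

theorem size_append (l l' : List α) : size (l ++ l') + 1 = size l + size l' := by
  induction l with
  | nil => simp; omega
  | cons a l ih => simp; omega

@[simp] theorem size_reverse (l : List α) : size l.reverse = size l := by
  induction l with
  | nil => rfl
  | cons a l ih =>
    have := size_append l.reverse [a]
    simp at this ⊢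
    omega

theorem size_sublist {l l' : List α} (h : l.Sublist l') : size l ≤ size l' := by
  induction h with
  | slnil => rfl
  | cons _ _ ih => simp; omega
  | cons_cons _ _ ih => simp; omega

theorem length_lt_size (l : List α) : l.length < size l := by
  induction l with
  | nil => simp
  | cons a l ih => simp; omega

theorem size_le_of_mem {l : List α} {a : α} (h : a ∈ l) : size a ≤ size l := by
  induction l with
  | nil => simp at h
  | cons b l ih =>
    rcases List.mem_cons.1 h with rfl | h
    · simp; omega
    · have := ih h
      simp; omega

theorem size_list_le {l : List α} {B : ℕ} (h : ∀ a ∈ l, size a ≤ B) :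
    size l ≤ l.length * (B + 1) + 1 := by
  induction l with
  | nil => simp
  | cons a l ih =>
    have h₁ := h a (by simp)
    have h₂ := ih fun b hb => h b (by simp [hb])
    simp [Nat.add_mul] at h₂ ⊢
    omega

theorem code_pair_eq (x : α) (y : β) : code (x, y) = .node (code x) (code y) := rfl

theorem code_nil : code ([] : List α) = .nil := rfl

theorem code_cons (a : α) (l : List α) : code (a :: l) = .node (code a) (code l) := rfl

theorem code_injective_bool : Function.Injective (code : Bool → Data) := by
  intro a b h
  cases a <;> cases b <;> first | rfl | cases h

theorem code_injective_symbol : Function.Injective (code : Symbol → Data) := by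
  intro a b h
  rcases a with (_ | _) | _ | _ <;> rcases b with (_ | _) | _ | _ <;> first | rfl | cases h

theorem code_injective_pair (hα : Function.Injective (code : α → Data))
    (hβ : Function.Injective (code : β → Data)) : Function.Injective (code : α × β → Data) := by
  rintro ⟨a, b⟩ ⟨a', b'⟩ h
  rw [code_pair_eq, code_pair_eq, Data.node.injEq] at h
  rw [hα h.1, hβ h.2]

theorem code_injective_list (hα : Function.Injective (code : α → Data)) :
    Function.Injective (code : List α → Data) := by
  intro l
  induction l with
  | nil => intro l' h; cases l' with
    | nil => rfl
    | cons => cases h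
  | cons a l ih => intro l' h; cases l' with
    | nil => cases h
    | cons b l' =>
      rw [code_cons, code_cons, Data.node.injEq] at h
      rw [hα h.1, ih h.2]

theorem code_injective_nat : Function.Injective (code : ℕ → Data) := fun _ _ h =>
  Computability.encodingNatBool.encode_injective (code_injective_list code_injective_bool h)

theorem code_injective_int : Function.Injective (code : ℤ → Data) := by
  intro a b h
  have h' := code_injective_pair code_injective_bool
    (code_injective_list code_injective_bool) h
  rw [Prod.mk.injEq, decide_eq_decide] at h'
  have := Computability.encodingNatBool.encode_injective h'.2
  have := h'.1
  omega

end

namespace Prog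

/-- Push the `i`-th bit of the code of the last input symbol. -/
def pushSymBit (i : ℕ) : Prog :=
  .push .main fun v => (v.sym.elim [] fun s => s.toData.word).getD i false

/-- Put the last input symbol in front of the list on the main stack. -/
def pushSym : Prog :=
  pushSymBit 6 ;; pushSymBit 5 ;; pushSymBit 4 ;; pushSymBit 3 ;; pushSymBit 2 ;; pushSymBit 1 ;;
    pushSymBit 0 ;; .push .main fun _ => true

theorem exec_pushSym (s : Symbol) (b f : Option Bool) (l : List Symbol) (w : List Bool) :
    Exec pushSym ⟨some s, b, f⟩ ⟨l, [], w, [], [], []⟩ 8 ⟨some s, b, f⟩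
      ⟨l, [], true :: (s.toData.word ++ w), [], [], []⟩ := by
  rcases s with (_ | _) | _ | _ <;>
    exact .seq .push (.seq .push (.seq .push (.seq .push (.seq .push (.seq .push
      (.seq .push .push))))))

/-- Build the tree of the reversed input on the main stack. -/
def loadInput : Prog :=
  .push .main (fun _ => false) ;; .read ;; .loop (fun v => v.sym.isSome) (pushSym ;; .read)

theorem exec_loadInput (l : List Symbol) (v : Reg) :
    ∃ v', Exec loadInput v ⟨l, [], [], [], [], []⟩ (10 * l.length + 3) v'
      ⟨[], [], (code l.reverse).word, [], [], []⟩ := by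
  have key : ∀ (l d : List Symbol) (b f : Option Bool), ∃ v',
      Exec (.loop (fun v => v.sym.isSome) (pushSym ;; .read)) ⟨l.head?, b, f⟩
        ⟨l.tail, [], (code d).word, [], [], []⟩ (10 * l.length + 1) v'
        ⟨[], [], (code (l.reverse ++ d)).word, [], [], []⟩ := by
    intro l
    induction l with
    | nil => exact fun d b f => ⟨_, .loopFalse rfl⟩
    | cons s l ih =>
      intro d b f
      obtain ⟨v', h⟩ := ih (s :: d) b f
      refine ⟨v', ?_⟩
      rw [show 10 * (s :: l).length + 1 = (8 + 1) + 1 + (10 * l.length + 1) by simp; ring,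
        List.reverse_cons, List.append_assoc]
      exact .loopTrue rfl (.seq (exec_pushSym s b f l (code d).word) .read) h
  obtain ⟨v', h⟩ := key l [] v.bit v.flag
  refine ⟨v', ?_⟩
  rw [show 10 * l.length + 3 = 1 + (1 + (10 * l.length + 1)) by ring]
  rw [List.append_nil] at h
  exact .seq .push (.seq .read h)

/-- Read a list of bits from the main stack. -/
def readBits : Prog :=
  .pop .main ;; .loop (fun v => v.bit.getD false)
    (.pop .main ;; .ite (fun v => v.bit.getD false)
      (.pop .main ;; .pop .main ;; .push .rev fun _ => true) (.push .rev fun _ => false) ;;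
      .pop .main)

theorem exec_readBits (l : List Bool) (v : Reg) :
    ∃ v' t, t ≤ 7 * l.length + 2 ∧ Exec readBits v ⟨[], [], (code l).word, [], [], []⟩ t v'
      ⟨[], [], [], l.reverse, [], []⟩ := by
  have key : ∀ (l d : List Bool) (v : Reg), v.bit = (code l).word.head? →
      ∃ v' t, t ≤ 7 * l.length + 1 ∧ Exec (.loop (fun v => v.bit.getD false)
    (.pop .main ;; .ite (fun v => v.bit.getD false)
      (.pop .main ;; .pop .main ;; .push .rev fun _ => true) (.push .rev fun _ => false) ;;
      .pop .main)) v ⟨[], [], (code l).word.tail, d, [], []⟩ t v'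
      ⟨[], [], [], l.reverse ++ d, [], []⟩ := by
    intro l
    induction l with
    | nil => exact fun d v hv => ⟨v, 1, le_rfl, .loopFalse (by rw [hv]; rfl)⟩
    | cons b l ih =>
      intro d v hv
      obtain ⟨v', t, ht, h⟩ := ih (b :: d) ⟨v.sym, (code l).word.head?, v.flag⟩ rfl
      rw [List.reverse_cons, List.append_assoc]
      cases b
      · exact ⟨v', _, by simp; omega,
          .loopTrue (by rw [hv]; rfl) (.seq .pop (.seq (.iteFalse rfl .push) .pop)) h⟩
      · exact ⟨v', _, by simp; omega, .loopTrue (by rw [hv]; rfl)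
          (.seq .pop (.seq (.iteTrue rfl (.seq .pop (.seq .pop .push))) .pop)) h⟩
  obtain ⟨v', t, ht, h⟩ := key l [] ⟨v.sym, (code l).word.head?, v.flag⟩ rfl
  rw [List.append_nil] at h
  exact ⟨v', 1 + t, by omega, .seq .pop h⟩

/-- Write the list of bits on the main stack to the output. -/
def writeOutput : Prog := readBits ;; drain .rev (.write fun v => v.bit.getD false)

theorem exec_writeOutput (l : List Bool) (v : Reg) :
    ∃ v' t, t ≤ 10 * l.length + 4 ∧ Exec writeOutput v ⟨[], [], (code l).word, [], [], []⟩ t v'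
      ⟨[], l, [], [], [], []⟩ := by
  obtain ⟨v₁, t₁, ht₁, h₁⟩ := exec_readBits l v
  obtain ⟨v₂, h₂⟩ := exec_drain (k := .rev) (c := 1) (p := .write fun v => v.bit.getD false)
    (fun l d => ⟨[], d, [], l, [], []⟩) (fun _ _ => rfl) l.reverse []
    (fun v b l d hv => ⟨v, by
      have := @Exec.write (fun v => v.bit.getD false) v ⟨[], d, [], l, [], []⟩
      simp only [hv] at this
      exact this⟩) (fun _ => rfl) v₁
  rw [List.reverse_reverse, List.append_nil] at h₂
  exact ⟨v₂, _, by simp; omega, .seq h₁ h₂⟩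

end Prog

/-! ### Functions computable in polynomial time relative to a measure -/

section

variable {X α β γ S : Type} [Code X] [Code α] [Code β] [Code γ] [Code S]

/-- `b x` is bounded by a polynomial in `m x` and the size of `x`. -/
def PolyBdd (m b : X → ℕ) : Prop := ∃ c, ∀ x, b x ≤ (m x + size x + 2) ^ c

namespace PolyBdd

variable {m b b' : X → ℕ}

theorem mono (h : PolyBdd m b') (hb : ∀ x, b x ≤ b' x) : PolyBdd m b :=
  let ⟨c, hc⟩ := h
  ⟨c, fun x => (hb x).trans (hc x)⟩

theorem const (k : ℕ) : PolyBdd m fun _ => k :=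
  ⟨k, fun x => Nat.lt_two_pow_self.le.trans (Nat.pow_le_pow_left (by omega) k)⟩

theorem size : PolyBdd m size := ⟨1, fun x => by simp only [pow_one]; omega⟩

theorem measure : PolyBdd m m := ⟨1, fun x => by simp only [pow_one]; omega⟩

theorem add (h : PolyBdd m b) (h' : PolyBdd m b') : PolyBdd m fun x => b x + b' x := by
  obtain ⟨c, hc⟩ := h
  obtain ⟨d, hd⟩ := h'
  refine ⟨c + d + 1, fun x => ?_⟩
  have h₁ := (hc x).trans (Nat.pow_le_pow_right (by omega) (Nat.le_add_right c d))
  have h₂ := (hd x).trans (Nat.pow_le_pow_right (by omega) (Nat.le_add_left d c))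
  calc b x + b' x ≤ (m x + SolutionFree.size x + 2) ^ (c + d) * 2 := by omega
    _ ≤ _ := by rw [pow_succ]; exact Nat.mul_le_mul_left _ (by omega)

theorem mul (h : PolyBdd m b) (h' : PolyBdd m b') : PolyBdd m fun x => b x * b' x := by
  obtain ⟨c, hc⟩ := h
  obtain ⟨d, hd⟩ := h'
  exact ⟨c + d, fun x => by rw [pow_add]; exact Nat.mul_le_mul (hc x) (hd x)⟩

/-- Composition: a polynomial bound on the size of `f x` turns a polynomial bound in the size of
the argument of `b` into one in the size of `x`. -/
theorem comp {f : X → α} {b : α → ℕ} (hb : PolyBdd (fun _ => 0) b)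
    (hf : PolyBdd m fun x => SolutionFree.size (f x)) : PolyBdd m fun x => b (f x) := by
  obtain ⟨c, hc⟩ := hb
  obtain ⟨d, hd⟩ := hf
  refine ⟨(d + 2) * c, fun x => (hc (f x)).trans ?_⟩
  rw [pow_mul]
  refine Nat.pow_le_pow_left ?_ c
  have h₁ := hd x
  have h₂ : 1 ≤ (m x + SolutionFree.size x + 2) ^ d := Nat.one_le_pow _ _ (by omega)
  calc 0 + SolutionFree.size (f x) + 2 ≤ (m x + SolutionFree.size x + 2) ^ d * 2 ^ 2 := by
        dsimp only at *
        omega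
    _ ≤ _ := by
      rw [pow_add]
      exact Nat.mul_le_mul_left _ (Nat.pow_le_pow_left (by omega) 2)

end PolyBdd

/-- Some program computes `f` in time polynomial in the measure `m` and the size of the argument:
the argument `x` on the top of the main stack is replaced by `f x`. A bound on the size of the
values is included. -/
def PolyTime (m : X → ℕ) (f : X → α) : Prop :=
  ∃ (p : Prog) (T : X → ℕ), PolyBdd m T ∧ ∀ x, size (f x) ≤ T x ∧
    ∀ r, p.Does ((code x).word ++ r) ((code (f x)).word ++ r) (T x)

/-- Computability in polynomial time in the size of the argument. -/
abbrev PTime (f : X → α) : Prop := PolyTime (fun _ => 0) f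

namespace PolyTime

open Prog

variable {m : X → ℕ}

theorem size_bdd {f : X → α} (h : PolyTime m f) : PolyBdd m fun x => size (f x) :=
  let ⟨_, _, hT, h⟩ := h
  hT.mono fun x => (h x).1

/-- Computability depends only on the codes of the argument and the value. -/
theorem of_code_eq {f : X → α} {g : X → β} (hf : PolyTime m f)
    (h : ∀ x, code (g x) = code (f x)) : PolyTime m g := by
  obtain ⟨p, T, hT, hp⟩ := hf
  refine ⟨p, T, hT, fun x => ?_⟩
  have := hp x
  rw [size, h]
  exact this

theorem congr {f g : X → α} (hf : PolyTime m f) (h : ∀ x, g x = f x) : PolyTime m g :=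
  hf.of_code_eq fun x => by rw [h]

theorem id : PolyTime m fun x : X => x :=
  ⟨skip, fun x => size x + 1, PolyBdd.size.add (.const 1), fun x => ⟨by (dsimp only at *; omega), fun r =>
    (does_skip _).mono (Nat.le_add_left _ _)⟩⟩

theorem comp {f : X → α} {g : α → β} (hg : PTime g) (hf : PolyTime m f) :
    PolyTime m fun x => g (f x) := by
  have hfs := hf.size_bdd
  obtain ⟨p, T, hT, hp⟩ := hf
  obtain ⟨q, U, hU, hq⟩ := hg
  refine ⟨p ;; q, fun x => T x + U (f x), hT.add (hU.comp hfs), fun x => ⟨?_, fun r => ?_⟩⟩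
  · have := (hq (f x)).1
    (dsimp only at *; omega)
  · exact ((hp x).2 r).seq ((hq (f x)).2 r)

/-- Polynomial time in the size of the input is polynomial time relative to every measure. -/
theorem of_pTime {f : X → α} (hf : PTime f) : PolyTime m f := comp hf .id

theorem const (a : α) : PolyTime m fun _ : X => a := by
  refine ⟨drop ;; pushWord (code a).word, fun x => (9 * size x + 5) + (size a + 1),
    (((PolyBdd.const 9).mul .size).add (.const 5)).add (.const _),
    fun x => ⟨by (dsimp only at *; omega), fun r => ?_⟩⟩
  exact (does_drop _ r).seq (does_pushWord _ r)

/-- Evaluate two functions on the same argument, leaving both values on the stack. -/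
def both (p q : Prog) : Prog := dup ;; q ;; swap ;; p

theorem does_both {p q : Prog} {x : X} {a : α} {b : β} {r : List Bool} {T U : ℕ}
    (hp : ∀ r, p.Does ((code x).word ++ r) ((code a).word ++ r) T)
    (hq : ∀ r, q.Does ((code x).word ++ r) ((code b).word ++ r) U) :
    (both p q).Does ((code x).word ++ r) ((code a).word ++ ((code b).word ++ r))
      (T + U + 25 * size x + 9 * size b + 19) :=
  ((does_dup _ r).seq ((hq _).seq ((does_swap _ _ r).seq (hp _)))).mono (by
    simp only [size]; omega)

theorem pair {f : X → α} {g : X → β} (hf : PolyTime m f) (hg : PolyTime m g) :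
    PolyTime m fun x => (f x, g x) := by
  have hgs := hg.size_bdd
  obtain ⟨p, T, hT, hp⟩ := hf
  obtain ⟨q, U, hU, hq⟩ := hg
  refine ⟨both p q ;; .push .main fun _ => true,
    fun x => (T x + U x + 25 * size x + 9 * size (g x) + 19) + 1,
    ((((hT.add hU).add ((PolyBdd.const 25).mul .size)).add ((PolyBdd.const 9).mul hgs)).add
      (.const 19)).add (.const 1), fun x => ⟨?_, fun r => ?_⟩⟩
  · have h₁ := (hp x).1
    have h₂ := (hq x).1
    rw [size_pair]
    (dsimp only at *; omega)
  · refine (does_both (hp x).2 (hq x).2).seq fun v => ⟨v, 1, le_rfl, ?_⟩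
    have := @Exec.push .main (fun _ => true) v
      ⟨[], [], (code (f x)).word ++ ((code (g x)).word ++ r), [], [], []⟩
    rw [code_pair_eq, Data.word, List.cons_append, List.append_assoc]
    exact this

theorem data_fst : PTime Data.fst := by
  refine ⟨popIte (swap ;; drop) (pushWord [false]), fun x => 18 * size x + 20,
    ((PolyBdd.const 18).mul .size).add (.const 20), fun x => ⟨?_, fun r => ?_⟩⟩
  · exact (Data.length_word_fst_le x).trans
      (by simp only [size]; change _ ≤ 18 * x.word.length + 20; omega)
  · rcases x with _ | ⟨a, b⟩
    · exact (does_popIte_false (does_pushWord [false] r)).mono (by simp)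
    · have := does_popIte_true (q := pushWord [false]) ((does_swap a b r).seq (does_drop b _))
      rw [← List.append_assoc a.word] at this
      refine this.mono ?_
      simp only [size]
      change _ ≤ 18 * (true :: (a.word ++ b.word)).length + 20
      simp; omega

theorem data_snd : PTime Data.snd := by
  refine ⟨popIte drop (pushWord [false]), fun x => 18 * size x + 20,
    ((PolyBdd.const 18).mul .size).add (.const 20), fun x => ⟨?_, fun r => ?_⟩⟩
  · exact (Data.length_word_snd_le x).trans
      (by simp only [size]; change _ ≤ 18 * x.word.length + 20; omega)
  · rcases x with _ | ⟨a, b⟩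
    · exact (does_popIte_false (does_pushWord [false] r)).mono (by simp)
    · have := does_popIte_true (q := pushWord [false]) (does_drop a (b.word ++ r))
      rw [← List.append_assoc a.word] at this
      refine this.mono ?_
      simp only [size]
      change _ ≤ 18 * (true :: (a.word ++ b.word)).length + 20
      simp; omega

theorem toData {f : X → α} (hf : PolyTime m f) : PolyTime m fun x => code (f x) :=
  hf.of_code_eq fun _ => rfl

theorem fst {f : X → α × β} (hf : PolyTime m f) : PolyTime m fun x => (f x).1 :=
  (data_fst.comp hf.toData).of_code_eq fun _ => rfl

theorem snd {f : X → α × β} (hf : PolyTime m f) : PolyTime m fun x => (f x).2 :=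
  (data_snd.comp hf.toData).of_code_eq fun _ => rfl

theorem cons {f : X → α} {g : X → List α} (hf : PolyTime m f) (hg : PolyTime m g) :
    PolyTime m fun x => f x :: g x :=
  (hf.pair hg).of_code_eq fun _ => rfl

/-- Case distinction: `F x` is computed by `f` or by `g`, depending on whether the tree `t x` is
`Data.nil`. -/
theorem data_cases {t : X → Data} {f g F : X → α} (ht : PolyTime m t) (hf : PolyTime m f)
    (hg : PolyTime m g) (h₁ : ∀ x, t x = .nil → F x = f x)
    (h₂ : ∀ x, t x ≠ .nil → F x = g x) : PolyTime m F := by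
  have hts := ht.size_bdd
  obtain ⟨p, T, hT, hp⟩ := ht
  obtain ⟨q, U, hU, hq⟩ := hf
  obtain ⟨q', V, hV, hq'⟩ := hg
  refine ⟨dup ;; p ;; popIte (drop ;; drop ;; q') q,
    fun x => 16 * size x + T x + 18 * size (t x) + U x + V x + 30,
    (((((PolyBdd.const 16).mul .size |>.add hT).add ((PolyBdd.const 18).mul hts)).add hU).add
      hV).add (.const 30), fun x => ⟨?_, fun r => ?_⟩⟩
  · by_cases h : t x = .nil
    · rw [h₁ x h]
      have := (hq x).1
      (dsimp only at *; omega)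
    · rw [h₂ x h]
      have := (hq' x).1
      (dsimp only at *; omega)
  · have h₀ := (does_dup (code x) r).seq ((hp x).2 _ |>.seq (T' := U x + V x + 18 * size (t x) + 20)
      (q := popIte (drop ;; drop ;; q') q) (w'' := (code (F x)).word ++ r) ?_)
    · exact h₀.mono (by simp only [size]; omega)
    rcases h : t x with _ | ⟨a, b⟩
    · rw [h₁ x h]
      exact (does_popIte_false ((hq x).2 r)).mono (by omega)
    · rw [h₂ x (by simp [h])]
      have := does_popIte_true (q := q) ((does_drop a (b.word ++ ((code x).word ++ r))).seq
        ((does_drop b _).seq ((hq' x).2 r)))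
      rw [← List.append_assoc a.word] at this
      refine this.mono ?_
      simp only [size]
      change _ ≤ U x + V x + 18 * (true :: (a.word ++ b.word)).length + 20
      simp; omega

/-- Conditional. -/
theorem ite {b : X → Bool} {f g : X → α} (hb : PolyTime m b) (hf : PolyTime m f)
    (hg : PolyTime m g) : PolyTime m fun x => if b x = true then f x else g x := by
  refine data_cases hb.toData hg hf (fun x hx => ?_) fun x hx => ?_
  · cases h : b x
    · simp
    · rw [h] at hx; cases hx
  · cases h : b x
    · rw [h] at hx; exact absurd rfl hx
    · simp

/-- Equality test, for types on which the codes are injective. -/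
theorem eq [DecidableEq α] {f g : X → α} (hα : Function.Injective (code : α → Data))
    (hf : PolyTime m f) (hg : PolyTime m g) : PolyTime m fun x => decide (f x = g x) := by
  have hfs := hf.size_bdd
  have hgs := hg.size_bdd
  obtain ⟨p, T, hT, hp⟩ := hf
  obtain ⟨q, U, hU, hq⟩ := hg
  refine ⟨both p q ;; equal, fun x => (T x + U x + 25 * size x + 9 * size (g x) + 19) +
      (20 * size (f x) + 20 * size (g x) + 40),
    ((((hT.add hU).add ((PolyBdd.const 25).mul .size)).add ((PolyBdd.const 9).mul hgs)).add
      (.const 19)).add ((((PolyBdd.const 20).mul hfs).add ((PolyBdd.const 20).mul hgs)).add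
      (.const 40)), fun x => ⟨?_, fun r => ?_⟩⟩
  · exact (size_bool_le _).trans (by (dsimp only at *; omega))
  · have h := does_equal (code (f x)) (code (g x)) r
    dsimp only
    rw [show decide (f x = g x) = @decide _ (Classical.propDecidable (code (f x) = code (g x)))
      from decide_eq_decide.2 hα.eq_iff.symm]
    exact (does_both (hp x).2 (hq x).2).seq h

/-- Case distinction for a list. -/
theorem list_cases {l : X → List α} {f F : X → β} {g : X × (α × List α) → β}
    (hl : PolyTime m l) (hf : PolyTime m f) (hg : PTime g) (h₁ : ∀ x, l x = [] → F x = f x)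
    (h₂ : ∀ x a l', l x = a :: l' → F x = g (x, (a, l'))) : PolyTime m F := by
  have hls := hl.size_bdd
  obtain ⟨p, T, hT, hp⟩ := hl
  obtain ⟨q, U, hU, hq⟩ := hf
  obtain ⟨q', ⟨V, ⟨c, hV⟩, hq'⟩⟩ := hg
  have hB : PolyBdd m fun x => (size x + size (l x) + 3) ^ c :=
    PolyBdd.comp (f := fun x => (x, l x)) (b := fun y => (size y + 2) ^ c)
      ⟨c, fun y => by simp⟩ ((((PolyBdd.size (m := m)).add hls).add (.const 1)).mono
        fun x => by simp) |>.mono fun x => by simp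
  refine ⟨dup ;; p ;; popIte (.push .main (fun _ => true) ;; swap ;; .push .main (fun _ => true) ;;
      q') q,
    fun x => 25 * size x + T x + 9 * size (l x) + U x + (size x + size (l x) + 3) ^ c + 30,
    ((((((PolyBdd.const 25).mul .size).add hT).add ((PolyBdd.const 9).mul hls)).add hU).add
      hB).add (.const 30), fun x => ?_⟩
  have hb : ∀ a l', l x = a :: l' → V (x, (a, l')) ≤ (size x + size (l x) + 3) ^ c := by
    intro a l' h
    refine (hV _).trans (Nat.pow_le_pow_left ?_ c)
    rw [h, size_pair, size_pair, size_cons]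
    dsimp only
    omega
  refine ⟨?_, fun r => ?_⟩
  · rcases h : l x with _ | ⟨a, l'⟩
    · rw [h₁ x h]
      have := (hq x).1
      (dsimp only at *; omega)
    · rw [h₂ x a l' h]
      have := (hq' (x, (a, l'))).1
      have := hb a l' h
      (dsimp only at *; omega)
  · have h₀ := (does_dup (code x) r).seq ((hp x).2 _ |>.seq
      (T' := U x + 9 * size x + 9 * size (l x) + (size x + size (l x) + 3) ^ c + 15)
      (q := popIte (.push .main (fun _ => true) ;; swap ;; .push .main (fun _ => true) ;; q') q)
      (w'' := (code (F x)).word ++ r) ?_)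
    · exact h₀.mono (by simp only [size]; omega)
    rcases h : l x with _ | ⟨a, l'⟩
    · rw [h₁ x h]
      exact (does_popIte_false ((hq x).2 r)).mono (by omega)
    · rw [h₂ x a l' h]
      have hb' := hb a l' h
      rw [h] at hb'
      have h₃ := (hq' (x, (a, l'))).2 r
      have h₄ := does_swap (code (a :: l')) (code x) r
      have h₅ : (Prog.push .main fun _ => true).Does
          ((code x).word ++ ((code (a :: l')).word ++ r))
          ((code (x, (a, l'))).word ++ r) 1 := by
        intro v
        refine ⟨v, 1, le_rfl, ?_⟩
        have := @Exec.push .main (fun _ => true) v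
          ⟨[], [], (code x).word ++ ((code (a :: l')).word ++ r), [], [], []⟩
        rw [code_pair_eq, Data.word, List.cons_append, List.append_assoc]
        exact this
      have h₆ : (Prog.push .main fun _ => true).Does
          ((code a).word ++ (code l').word ++ ((code x).word ++ r))
          ((code (a :: l')).word ++ ((code x).word ++ r)) 1 := fun v =>
        ⟨v, 1, le_rfl, .push⟩
      refine (does_popIte_true (q := q) (h₆.seq (h₄.seq (h₅.seq h₃)))).mono ?_
      have e₁ : size (a :: l') = (code (a :: l')).word.length := rfl
      have e₂ : size x = (code x).word.length := rfl
      omega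

/-- The rule for iteration along a list. The step function may use the argument `x`; the sizes of
all intermediate results have to be bounded. -/
theorem foldl {l : X → List α} {s : X → S} {g : X → S → α → S} {B : X → ℕ}
    (hl : PolyTime m l) (hs : PolyTime m s)
    (hg : PTime fun y : X × (S × α) => g y.1 y.2.1 y.2.2) (hB : PolyBdd m B)
    (hsize : ∀ x l', l' <+: l x → size (l'.foldl (g x) (s x)) ≤ B x) :
    PolyTime m fun x => (l x).foldl (g x) (s x) := by
  have hbody : PTime fun y : (α × List α) × (S × X) =>
      (y.1.2, (g y.2.2 y.2.1 y.1.1, y.2.2)) :=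
    id.fst.snd.pair ((hg.comp (id.snd.snd.pair (id.snd.fst.pair id.fst.fst))).pair id.snd.snd)
  have hls := hl.size_bdd
  obtain ⟨p, T, hT, hp⟩ := hl.pair (hs.pair id)
  obtain ⟨q, U, ⟨c, hU⟩, hq⟩ := hbody
  have hC : PolyBdd m fun x => (size (l x) + B x + size x + 5) ^ c := by
    obtain ⟨d, hd⟩ := ((hls.add hB).add (.size)).add (.const 5)
    exact ⟨d * c, fun x => by rw [pow_mul]; exact Nat.pow_le_pow_left (hd x) c⟩
  have key : PolyTime m fun x => (([] : List α), ((l x).foldl (g x) (s x), x)) := by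
    refine ⟨p ;; whileFst q, fun x => T x +
        (((size (l x) + B x + size x + 5) ^ c + 4) * size (l x) + 4) + (B x + size x + 3),
      (hT.add (((hC.add (.const 4)).mul hls).add (.const 4))).add
        ((hB.add .size).add (.const 3)), fun x => ⟨?_, fun r => ?_⟩⟩
    · have := hsize x (l x) List.prefix_rfl
      simp
      omega
    · have h := does_whileFst (p := q) (r := r) (n := (l x).length)
        (T := (size (l x) + B x + size x + 5) ^ c)
        (fun i => code ((l x).drop i))
        (fun i => code (((l x).take i).foldl (g x) (s x), x)) ?_ ?_ ?_
      · simp only [List.drop_zero, List.drop_length, List.take_zero, List.take_length,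
          List.foldl_nil] at h
        refine (((hp x).2 r).seq h).mono ?_
        have := (length_lt_size (l x)).le
        have := Nat.mul_le_mul_left ((size (l x) + B x + size x + 5) ^ c + 4) this
        dsimp only
        omega
      · intro i hi
        rw [List.drop_eq_getElem_cons hi]
        exact fun h => by cases h
      · simp [code_nil]
      · intro i hi
        have h₁ := hq (((l x)[i], (l x).drop (i + 1)), (((l x).take i).foldl (g x) (s x), x))
        have h₂ := h₁.2 r
        have h₃ : g x (((l x).take i).foldl (g x) (s x)) (l x)[i] =
            ((l x).take (i + 1)).foldl (g x) (s x) := by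
          rw [← List.take_append_getElem hi, List.foldl_append]
          rfl
        simp only at h₂
        rw [h₃] at h₂
        rw [List.drop_eq_getElem_cons hi]
        refine h₂.mono ((hU _).trans (Nat.pow_le_pow_left ?_ c))
        have h₄ := hsize x _ (List.take_prefix i (l x))
        have h₅ := size_sublist (List.drop_sublist i (l x))
        rw [List.drop_eq_getElem_cons hi] at h₅
        rw [size_cons] at h₅
        rw [size_pair, size_pair, size_pair]
        dsimp only
        omega
  exact key.snd.fst

end PolyTime

/-! ### Truth values and lists -/

namespace PolyTime

variable {m : X → ℕ}

theorem not {b : X → Bool} (hb : PolyTime m b) : PolyTime m fun x => !b x :=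
  (hb.ite (const false) (const true)).congr fun x => by cases b x <;> rfl

theorem and {b c : X → Bool} (hb : PolyTime m b) (hc : PolyTime m c) :
    PolyTime m fun x => b x && c x :=
  (hb.ite hc (const false)).congr fun x => by cases b x <;> rfl

theorem or {b c : X → Bool} (hb : PolyTime m b) (hc : PolyTime m c) :
    PolyTime m fun x => b x || c x :=
  (hb.ite (const true) hc).congr fun x => by cases b x <;> rfl

/-- A function of finitely many truth values. -/
theorem of_bools_fin : ∀ {n : ℕ} (b : Fin n → X → Bool), (∀ i, PolyTime m (b i)) →
    ∀ F : (Fin n → Bool) → α, PolyTime m fun x => F fun i => b i x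
  | 0, _, _, F => (const (F Fin.elim0)).congr fun x => congrArg F (Subsingleton.elim _ _)
  | _ + 1, b, hb, F =>
    ((hb 0).ite (of_bools_fin (fun i => b i.succ) (fun i => hb i.succ) fun v => F (Fin.cons true v))
      (of_bools_fin (fun i => b i.succ) (fun i => hb i.succ) fun v => F (Fin.cons false v))).congr
      fun x => by
        have : (fun i => b i x) = Fin.cons (b 0 x) fun i => b i.succ x := by
          funext i
          refine Fin.cases ?_ (fun i => ?_) i <;> simp
        rw [this]
        cases b 0 x <;> rfl

theorem of_bools {ι : Type} [Finite ι] (b : ι → X → Bool) (hb : ∀ i, PolyTime m (b i))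
    (F : (ι → Bool) → α) : PolyTime m fun x => F fun i => b i x := by
  obtain ⟨n, ⟨e⟩⟩ := Finite.exists_equiv_fin ι
  exact (of_bools_fin (fun i => b (e.symm i)) (fun i => hb _)
    fun v => F fun i => v (e i)).congr fun x => by simp

theorem tail {l : X → List α} (hl : PolyTime m l) : PolyTime m fun x => (l x).tail :=
  hl.list_cases (const []) id.snd.snd (fun x h => by simp [h]) fun x a l' h => by simp [h]

theorem headD {l : X → List α} {a : X → α} (hl : PolyTime m l) (ha : PolyTime m a) :
    PolyTime m fun x => (l x).headD (a x) :=
  hl.list_cases ha id.snd.fst (fun x h => by simp [h]) fun x a l' h => by simp [h]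

theorem isEmpty {l : X → List α} (hl : PolyTime m l) : PolyTime m fun x => (l x).isEmpty :=
  hl.list_cases (const true) (const false) (fun x h => by simp [h]) fun x a l' h => by simp [h]

theorem reverse {l : X → List α} (hl : PolyTime m l) : PolyTime m fun x => (l x).reverse := by
  refine (hl.foldl (s := fun _ => []) (g := fun _ s a => a :: s) (B := fun x => size (l x))
    (const []) (id.snd.snd.cons id.snd.fst) hl.size_bdd fun x l' h => ?_).congr fun x => ?_
  · rw [List.foldl_flip_cons_eq_append', List.append_nil, size_reverse]
    exact size_sublist h.sublist
  · rw [List.foldl_flip_cons_eq_append', List.append_nil]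

/-- Iteration along a list, starting from its end. -/
theorem foldr {l : X → List α} {s : X → S} {g : X → α → S → S} {B : X → ℕ}
    (hl : PolyTime m l) (hs : PolyTime m s)
    (hg : PTime fun y : X × (α × S) => g y.1 y.2.1 y.2.2) (hB : PolyBdd m B)
    (hsize : ∀ x l', l' <:+ l x → size (l'.foldr (g x) (s x)) ≤ B x) :
    PolyTime m fun x => (l x).foldr (g x) (s x) := by
  refine (hl.reverse.foldl (g := fun x s a => g x a s) hs
    (hg.comp (id.fst.pair (id.snd.snd.pair id.snd.fst))) hB fun x l' h => ?_).congr fun x => ?_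
  · have := hsize x l'.reverse (by rwa [← List.reverse_prefix, List.reverse_reverse])
    rwa [List.foldr_reverse] at this
  · rw [List.foldl_reverse]

theorem append {l l' : X → List α} (hl : PolyTime m l) (hl' : PolyTime m l') :
    PolyTime m fun x => l x ++ l' x := by
  refine (hl.foldr (g := fun _ a s => a :: s) (B := fun x => size (l x) + size (l' x))
    hl' (id.snd.fst.cons id.snd.snd) (hl.size_bdd.add hl'.size_bdd) fun x l₁ h => ?_).congr
    fun x => by simp
  have h₁ := size_append l₁ (l' x)
  have h₂ := size_sublist h.sublist
  simp only [List.foldr_cons_eq_append']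
  simp at h₁ ⊢
  omega

/-- The values of a polynomial-time function along a list have polynomially bounded size. -/
theorem exists_size_le {l : X → List α} (hl : PolyTime m l) {f : X → α → β}
    (hf : PTime fun y : X × α => f y.1 y.2) :
    ∃ B, PolyBdd m B ∧ ∀ x, ∀ a ∈ l x, size (f x a) ≤ B x := by
  obtain ⟨c, hc⟩ := hf.size_bdd
  obtain ⟨d, hd⟩ := (((PolyBdd.size (m := m)).add hl.size_bdd).add (.const 3))
  refine ⟨fun x => (size x + size (l x) + 3) ^ c,
    ⟨d * c, fun x => by rw [pow_mul]; exact Nat.pow_le_pow_left (hd x) c⟩, fun x a ha => ?_⟩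
  refine (hc (x, a)).trans (Nat.pow_le_pow_left ?_ c)
  have := size_le_of_mem ha
  rw [size_pair]
  dsimp only
  omega

theorem length_bdd {l : X → List α} (hl : PolyTime m l) : PolyBdd m fun x => (l x).length :=
  hl.size_bdd.mono fun _ => (length_lt_size _).le

theorem map {l : X → List α} (hl : PolyTime m l) {f : X → α → β}
    (hf : PTime fun y : X × α => f y.1 y.2) : PolyTime m fun x => (l x).map (f x) := by
  obtain ⟨B, hB, h⟩ := exists_size_le hl hf
  refine (hl.foldr (s := fun _ => []) (g := fun x a s => f x a :: s)
    (B := fun x => (l x).length * (B x + 1) + 1) (const [])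
    ((hf.comp (id.fst.pair id.snd.fst)).cons id.snd.snd)
    ((hl.length_bdd.mul (hB.add (.const 1))).add (.const 1)) fun x l' hl' => ?_).congr
    fun x => by rw [List.map_eq_foldr]
  rw [← List.map_eq_foldr]
  refine (size_list_le (B := B x) fun b hb => ?_).trans ?_
  · obtain ⟨a, ha, rfl⟩ := List.mem_map.1 hb
    exact h x a (hl'.subset ha)
  · rw [List.length_map]
    exact Nat.succ_le_succ (Nat.mul_le_mul_right _ hl'.length_le)

theorem size_flatMap_le {ι : Type} {l : List ι} {f : ι → List β} {B : ℕ}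
    (h : ∀ a ∈ l, size (f a) ≤ B) :
    size (l.flatMap f) ≤ l.length * B + 1 := by
  induction l with
  | nil => simp
  | cons a l ih =>
    have h₁ := h a (by simp)
    have h₂ := ih fun b hb => h b (by simp [hb])
    have h₃ := size_append (f a) (l.flatMap f)
    rw [List.flatMap_cons, List.length_cons, Nat.add_mul]
    omega

theorem flatMap {l : X → List α} (hl : PolyTime m l) {f : X → α → List β}
    (hf : PTime fun y : X × α => f y.1 y.2) : PolyTime m fun x => (l x).flatMap (f x) := by
  obtain ⟨B, hB, h⟩ := exists_size_le hl hf
  have e : ∀ x (l' : List α), l'.foldr (fun a s => f x a ++ s) [] = l'.flatMap (f x) := by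
    intro x l'
    induction l' with
    | nil => rfl
    | cons a l' ih => rw [List.foldr_cons, ih, List.flatMap_cons]
  refine (hl.foldr (s := fun _ => []) (g := fun x a s => f x a ++ s)
    (B := fun x => (l x).length * B x + 1) (const [])
    ((hf.comp (id.fst.pair id.snd.fst)).append id.snd.snd)
    ((hl.length_bdd.mul hB).add (.const 1)) fun x l' hl' => ?_).congr
    fun x => (e x _).symm
  rw [e]
  exact (size_flatMap_le fun a ha => h x a (hl'.subset ha)).trans
    (Nat.succ_le_succ (Nat.mul_le_mul_right _ hl'.length_le))

theorem filter {l : X → List α} (hl : PolyTime m l) {p : X → α → Bool}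
    (hp : PTime fun y : X × α => p y.1 y.2) : PolyTime m fun x => (l x).filter (p x) := by
  have e : ∀ x (l' : List α), l'.foldr (fun a s => if p x a = true then a :: s else s) [] =
      l'.filter (p x) := by
    intro x l'
    induction l' with
    | nil => rfl
    | cons a l' ih => rw [List.foldr_cons, ih, List.filter_cons]
  refine (hl.foldr (s := fun _ => []) (g := fun x a s => if p x a = true then a :: s else s)
    (B := fun x => size (l x)) (const [])
    ((hp.comp (id.fst.pair id.snd.fst)).ite (id.snd.fst.cons id.snd.snd) id.snd.snd)
    hl.size_bdd fun x l' hl' => ?_).congr fun x => (e x _).symm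
  rw [e]
  exact size_sublist (List.filter_sublist.trans hl'.sublist)

theorem any {l : X → List α} (hl : PolyTime m l) {p : X → α → Bool}
    (hp : PTime fun y : X × α => p y.1 y.2) : PolyTime m fun x => (l x).any (p x) := by
  refine (hl.foldr (s := fun _ => false) (g := fun x a s => p x a || s)
    (B := fun _ => 3) (const false)
    ((hp.comp (id.fst.pair id.snd.fst)).or id.snd.snd)
    (.const 3) fun x l' hl' => size_bool_le _).congr fun x => ?_
  induction l x with
  | nil => rfl
  | cons a l' ih => rw [List.any_cons, List.foldr_cons, ih]

/-- Membership in a list. -/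
theorem mem [DecidableEq α] (hα : Function.Injective (code : α → Data)) {a : X → α}
    {l : X → List α} (ha : PolyTime m a) (hl : PolyTime m l) :
    PolyTime m fun x => decide (a x ∈ l x) := by
  have h : PTime fun y : List α × α => y.1.any fun b => decide (b = y.2) :=
    id.fst.any (p := fun (y : List α × α) b => decide (b = y.2)) (eq hα id.snd id.fst.snd)
  exact (h.comp (hl.pair ha)).congr fun x => by
    rw [Bool.eq_iff_iff]; simp

end PolyTime

end

/-! ### Arithmetic of binary numbers -/

/-- The number with the given binary digits, the least significant digit first. -/
def bitsVal : List Bool → ℕ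
  | [] => 0
  | b :: l => b.toNat + 2 * bitsVal l

theorem bitsVal_append (l l' : List Bool) :
    bitsVal (l ++ l') = bitsVal l + 2 ^ l.length * bitsVal l' := by
  induction l with
  | nil => simp [bitsVal]
  | cons b l ih => simp [bitsVal, ih, pow_succ]; ring

theorem bitsVal_lt (l : List Bool) : bitsVal l < 2 ^ l.length := by
  induction l with
  | nil => simp [bitsVal]
  | cons b l ih =>
    have := Bool.toNat_le b
    simp [bitsVal, pow_succ]
    omega

theorem bitsVal_eq_headD (l : List Bool) :
    bitsVal l = (l.headD false).toNat + 2 * bitsVal l.tail := by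
  cases l <;> simp [bitsVal]

theorem encodeNat_pos (p : PosNum) :
    Computability.encodeNat (p : ℕ) = Computability.encodePosNum p := by
  rw [Computability.encodeNat]
  have : (((p : ℕ) : Num)) = Num.pos p := by
    rw [← Num.of_to_nat (Num.pos p)]
    rfl
  rw [this, Computability.encodeNum]

theorem encodeNat_zero : Computability.encodeNat 0 = [] := rfl

theorem encodeNat_bit (b : Bool) (n : ℕ) (h : b = true ∨ n ≠ 0) :
    Computability.encodeNat (b.toNat + 2 * n) = b :: Computability.encodeNat n := by
  rcases Nat.eq_zero_or_pos n with rfl | hn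
  · have hb : b = true := by simpa using h
    subst hb
    rfl
  · obtain ⟨p, rfl⟩ : ∃ p : PosNum, (p : ℕ) = n := by
      rcases hN : (n : Num) with _ | p
      · have := Num.to_of_nat n
        rw [hN] at this
        exact absurd this.symm hn.ne'
      · refine ⟨p, ?_⟩
        have := Num.to_of_nat n
        rw [hN] at this
        exact this
    rw [encodeNat_pos]
    cases b
    · have := encodeNat_pos p.bit0
      rw [PosNum.cast_bit0] at this
      rw [← Computability.encodePosNum, ← this]
      congr 1
      simp; ring
    · have := encodeNat_pos p.bit1
      rw [PosNum.cast_bit1] at this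
      rw [← Computability.encodePosNum, ← this]
      congr 1
      simp; ring

/-- The digits of the number with digits `l`: leading zeros are removed. -/
theorem encodeNat_bitsVal (l : List Bool) : Computability.encodeNat (bitsVal l) =
    l.foldr (fun b s => if (!b && s.isEmpty) = true then [] else b :: s) [] := by
  induction l with
  | nil => rfl
  | cons b l ih =>
    rw [List.foldr_cons, ← ih, bitsVal]
    rcases Nat.eq_zero_or_pos (bitsVal l) with h | h
    · cases b
      · simp [h, encodeNat_zero]
      · rw [encodeNat_bit _ _ (.inl rfl)]; simp
    · rw [encodeNat_bit _ _ (.inr h.ne'), if_neg]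
      simp only [Bool.and_eq_true, not_and, List.isEmpty_iff]
      intro _ h'
      have := Computability.decode_encodeNat (bitsVal l)
      rw [h'] at this
      exact h.ne this

theorem bitsVal_encodeNat (n : ℕ) : bitsVal (Computability.encodeNat n) = n := by
  induction n using Nat.strong_induction_on with
  | _ n ih =>
    rcases Nat.eq_zero_or_pos n with rfl | hn
    · rfl
    · have h : n = (decide (n % 2 = 1)).toNat + 2 * (n / 2) := by
        rcases Nat.mod_two_eq_zero_or_one n with h | h <;> simp [h] <;> omega
      have h' : decide (n % 2 = 1) = true ∨ n / 2 ≠ 0 := by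
        simp only [decide_eq_true_eq]; omega
      calc bitsVal (Computability.encodeNat n)
          = bitsVal (Computability.encodeNat ((decide (n % 2 = 1)).toNat + 2 * (n / 2))) := by
            rw [← h]
        _ = n := by rw [encodeNat_bit _ _ h', bitsVal, ih (n / 2) (by omega), ← h]

theorem length_encodeNat_le {k n : ℕ} (h : n < 2 ^ k) : (Computability.encodeNat n).length ≤ k := by
  induction k generalizing n with
  | zero =>
    obtain rfl : n = 0 := by simpa using h
    rfl
  | succ k ih =>
    rcases Nat.eq_zero_or_pos n with rfl | hn
    · simp [encodeNat_zero]
    · have h₁ : n = (decide (n % 2 = 1)).toNat + 2 * (n / 2) := by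
        rcases Nat.mod_two_eq_zero_or_one n with h | h <;> simp [h] <;> omega
      have h' : decide (n % 2 = 1) = true ∨ n / 2 ≠ 0 := by
        simp only [decide_eq_true_eq]; omega
      have h₂ : (Computability.encodeNat n).length =
          (Computability.encodeNat ((decide (n % 2 = 1)).toNat + 2 * (n / 2))).length := by rw [← h₁]
      rw [h₂, encodeNat_bit _ _ h', List.length_cons]
      exact Nat.succ_le_succ (ih (by rw [pow_succ] at h; omega))

theorem size_bits_le (l : List Bool) : size l ≤ 4 * l.length + 1 :=
  (size_list_le fun b _ => size_bool_le b).trans (by omega)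

theorem size_nat_le {k n : ℕ} (h : n < 2 ^ k) : size n ≤ 4 * k + 1 :=
  (size_bits_le _).trans (by have := length_encodeNat_le h; omega)

theorem lt_two_pow_size (n : ℕ) : n < 2 ^ size n := by
  have h := bitsVal_lt (Computability.encodeNat n)
  rw [bitsVal_encodeNat] at h
  exact h.trans_le (Nat.pow_le_pow_right (by norm_num) (length_lt_size (Computability.encodeNat n)).le)

theorem sum_lt_two_pow_size (l : List ℕ) : l.sum < 2 ^ size l := by
  induction l with
  | nil => simp
  | cons n l ih =>
    have h := lt_two_pow_size n
    rw [List.sum_cons, size_cons, pow_succ, pow_add]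
    have h₁ := Nat.one_le_two_pow (n := size n)
    have h₂ := Nat.one_le_two_pow (n := size l)
    nlinarith

/-- One step of the addition of binary numbers. The state consists of the remaining digits, the
carry, and the digits of the sum found so far in reverse order. -/
def addStep (s : (List Bool × List Bool) × (Bool × List Bool)) :
    (List Bool × List Bool) × (Bool × List Bool) :=
  let a := s.1.1.headD false
  let b := s.1.2.headD false
  let c := s.2.1
  ((s.1.1.tail, s.1.2.tail), ((a && b || a && c || b && c), (a ^^ (b ^^ c)) :: s.2.2))

/-- Invariant of the addition: the digits found, together with the shifted sum of the carry and the
remaining digits, represent the same number before and after a step. -/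
theorem addStep_val (s : (List Bool × List Bool) × (Bool × List Bool)) :
    bitsVal (addStep s).2.2.reverse + 2 ^ (addStep s).2.2.length *
        ((addStep s).2.1.toNat + bitsVal (addStep s).1.1 + bitsVal (addStep s).1.2) =
      bitsVal s.2.2.reverse + 2 ^ s.2.2.length *
        (s.2.1.toNat + bitsVal s.1.1 + bitsVal s.1.2) := by
  obtain ⟨⟨l, l'⟩, c, o⟩ := s
  simp only [addStep, List.reverse_cons, bitsVal_append, List.length_reverse, List.length_cons]
  rw [bitsVal_eq_headD l, bitsVal_eq_headD l', pow_succ]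
  cases l.headD false <;> cases l'.headD false <;> cases c <;> simp [bitsVal] <;> ring

theorem bitsVal_foldl_addStep (l l' : List Bool) :
    bitsVal ((l ++ false :: l').foldl (fun s _ => addStep s) ((l, l'), (false, []))).2.2.reverse =
      bitsVal l + bitsVal l' := by
  have h : ∀ (u : List Bool) (s : (List Bool × List Bool) × (Bool × List Bool)),
      (u.foldl (fun s _ => addStep s) s).2.2.length = s.2.2.length + u.length ∧
      bitsVal (u.foldl (fun s _ => addStep s) s).2.2.reverse +
        2 ^ (u.foldl (fun s _ => addStep s) s).2.2.length *
          ((u.foldl (fun s _ => addStep s) s).2.1.toNat +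
            bitsVal (u.foldl (fun s _ => addStep s) s).1.1 +
            bitsVal (u.foldl (fun s _ => addStep s) s).1.2) =
      bitsVal s.2.2.reverse + 2 ^ s.2.2.length *
        (s.2.1.toNat + bitsVal s.1.1 + bitsVal s.1.2) := by
    intro u
    induction u with
    | nil => exact fun s => ⟨by simp, rfl⟩
    | cons a u ih =>
      intro s
      rw [List.foldl_cons, (ih _).2, addStep_val, (ih _).1]
      exact ⟨by simp [addStep]; ring, rfl⟩
  obtain ⟨h₁, h₂⟩ := h (l ++ false :: l') ((l, l'), (false, []))
  -- the sum has fewer digits than there are steps, so that nothing remains at the end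
  generalize (l ++ false :: l').foldl (fun s _ => addStep s) ((l, l'), (false, [])) = s at h₁ h₂ ⊢
  have h₃ : bitsVal l + bitsVal l' < 2 ^ s.2.2.length := by
    have h₄ := bitsVal_lt l
    have h₅ := bitsVal_lt l'
    have h₆ : 2 ^ l.length ≤ 2 ^ (l.length + l'.length) := Nat.pow_le_pow_right (by norm_num) (by omega)
    have h₇ : 2 ^ l'.length ≤ 2 ^ (l.length + l'.length) :=
      Nat.pow_le_pow_right (by norm_num) (by omega)
    rw [h₁]
    simp only [List.length_append, List.length_cons, List.length_nil, Nat.zero_add, ← Nat.add_assoc,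
      pow_succ]
    omega
  simp only [List.reverse_nil, List.length_nil, bitsVal, Bool.toNat_false, pow_zero] at h₂
  rcases Nat.eq_zero_or_pos (s.2.1.toNat + bitsVal s.1.1 + bitsVal s.1.2) with h₄ | h₄
  · rw [h₄] at h₂
    omega
  · have := Nat.le_mul_of_pos_right (2 ^ s.2.2.length) h₄
    omega

namespace PolyTime

variable {X : Type} [Code X] {m : X → ℕ}

theorem size_foldl_addStep (u l l' : List Bool) :
    size (u.foldl (fun s _ => addStep s) ((l, l'), (false, []))) ≤
      size l + size l' + 4 * u.length + 7 := by
  have h : ∀ (u : List Bool) (s : (List Bool × List Bool) × (Bool × List Bool)),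
      size (u.foldl (fun s _ => addStep s) s).1.1 ≤ size s.1.1 ∧
      size (u.foldl (fun s _ => addStep s) s).1.2 ≤ size s.1.2 ∧
      size (u.foldl (fun s _ => addStep s) s).2.2 ≤ size s.2.2 + 4 * u.length := by
    intro u
    induction u with
    | nil => exact fun s => ⟨le_rfl, le_rfl, le_rfl⟩
    | cons a u ih =>
      intro s
      obtain ⟨h₁, h₂, h₃⟩ := ih (addStep s)
      have h₄ : size (addStep s).1.1 ≤ size s.1.1 := size_sublist (List.tail_sublist _)
      have h₅ : size (addStep s).1.2 ≤ size s.1.2 := size_sublist (List.tail_sublist _)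
      have h₆ : size (addStep s).2.2 ≤ size s.2.2 + 4 := by
        rw [addStep, size_cons]
        exact le_trans (Nat.succ_le_succ (Nat.add_le_add_right (size_bool_le _) _)) (by omega)
      rw [List.foldl_cons, List.length_cons]
      omega
  obtain ⟨h₁, h₂, h₃⟩ := h u ((l, l'), (false, []))
  generalize u.foldl (fun s _ => addStep s) ((l, l'), (false, [])) = s at *
  obtain ⟨⟨a, b⟩, c, d⟩ := s
  have := size_bool_le c
  simp at *
  omega

theorem addStep : PTime addStep := by
  have a : PTime fun s : (List Bool × List Bool) × (Bool × List Bool) => s.1.1.headD false :=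
    headD id.fst.fst (const false)
  have b : PTime fun s : (List Bool × List Bool) × (Bool × List Bool) => s.1.2.headD false :=
    headD id.fst.snd (const false)
  have c : PTime fun s : (List Bool × List Bool) × (Bool × List Bool) => s.2.1 := id.snd.fst
  have xor : ∀ {b c : (List Bool × List Bool) × (Bool × List Bool) → Bool}, PTime b → PTime c →
      PTime fun x => b x ^^ c x := fun {b c} hb hc =>
    (hb.ite hc.not hc).congr fun x => by cases b x <;> simp
  exact (id.fst.fst.tail.pair id.fst.snd.tail).pair
    ((((a.and b).or (a.and c)).or (b.and c)).pair ((xor a (xor b c)).cons id.snd.snd))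

theorem toBits {f : X → ℕ} (hf : PolyTime m f) :
    PolyTime m fun x => Computability.encodeNat (f x) := hf.of_code_eq fun _ => rfl

/-- Numbers may be computed by finding binary digits, with leading zeros allowed. -/
theorem of_bits {f : X → ℕ} {l : X → List Bool} (hl : PolyTime m l) (h : ∀ x, f x = bitsVal (l x)) :
    PolyTime m f := by
  refine (hl.foldr (s := fun _ => ([] : List Bool))
    (g := fun _ b s => if (!b && s.isEmpty) = true then [] else b :: s) (B := fun x => size (l x))
    (const []) ((id.snd.fst.not.and id.snd.snd.isEmpty).ite (const [])
      (id.snd.fst.cons id.snd.snd)) hl.size_bdd fun x l' hl' => ?_).of_code_eq fun x => ?_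
  · refine le_trans ?_ (size_sublist hl'.sublist)
    induction l' with
    | nil => rfl
    | cons b l' ih =>
      have := ih ((List.suffix_cons _ _).trans hl')
      rw [List.foldr_cons, size_cons]
      split_ifs
      · simp
      · rw [size_cons]
        omega
  · rw [← encodeNat_bitsVal, ← h]
    rfl

theorem add {f g : X → ℕ} (hf : PolyTime m f) (hg : PolyTime m g) :
    PolyTime m fun x => f x + g x := by
  have h : PTime fun y : ℕ × ℕ => y.1 + y.2 := by
    have h₁ : PTime fun y : ℕ × ℕ => Computability.encodeNat y.1 := id.fst.toBits
    have h₂ : PTime fun y : ℕ × ℕ => Computability.encodeNat y.2 := id.snd.toBits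
    have h₃ : PTime fun y : ℕ × ℕ =>
        (Computability.encodeNat y.1 ++ false :: Computability.encodeNat y.2).foldl
          (fun s _ => SolutionFree.addStep s)
          ((Computability.encodeNat y.1, Computability.encodeNat y.2), (false, [])) := by
      refine foldl (g := fun _ s _ => SolutionFree.addStep s) (B := fun y => 5 * size y + 20)
        (h₁.append ((const false).cons h₂)) ((h₁.pair h₂).pair ((const false).pair (const [])))
        (addStep.comp id.snd.fst) (((PolyBdd.const 5).mul .size).add (.const 20)) ?_
      intro y l' hl'
      refine (size_foldl_addStep _ _ _).trans ?_
      have e₁ := length_lt_size (Computability.encodeNat y.1)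
      have e₂ := length_lt_size (Computability.encodeNat y.2)
      have e₃ : size y = size (Computability.encodeNat y.1) + size (Computability.encodeNat y.2) + 1 :=
        size_pair _ _
      have := hl'.length_le
      simp only [List.length_append, List.length_cons] at this
      omega
    refine of_bits h₃.snd.snd.reverse fun y => ?_
    rw [bitsVal_foldl_addStep, bitsVal_encodeNat, bitsVal_encodeNat]
  exact (h.comp (hf.pair hg) :)

theorem sum {l : X → List ℕ} (hl : PolyTime m l) : PolyTime m fun x => (l x).sum := by
  refine (hl.foldr (s := fun _ => 0) (g := fun _ a s => a + s) (B := fun x => 4 * size (l x) + 1)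
    (const 0) (id.snd.fst.add id.snd.snd) (((PolyBdd.const 4).mul hl.size_bdd).add (.const 1))
    fun x l' hl' => ?_).congr fun x => rfl
  refine (size_nat_le (sum_lt_two_pow_size l')).trans ?_
  have := size_sublist hl'.sublist
  omega

theorem const_mul (c : ℕ) {f : X → ℕ} (hf : PolyTime m f) : PolyTime m fun x => c * f x := by
  induction c with
  | zero => exact (const 0).congr fun x => by simp
  | succ c ih => exact (ih.add hf).congr fun x => by ring

end PolyTime

/-! ### Binomial coefficients -/

/-- The sums of adjacent entries of a list; the first component of the value is the first entry of
the list. -/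
def adjacentSums (l : List ℕ) : ℕ × List ℕ := l.foldr (fun a s => (a, (a + s.1) :: s.2)) (0, [])

/-- The row of Pascal's triangle that follows the row `l`. -/
def nextRow (l : List ℕ) : List ℕ := 1 :: (adjacentSums l).2

theorem adjacentSums_spec (l : List ℕ) : (adjacentSums l).1 = l.getD 0 0 ∧
    (adjacentSums l).2.length = l.length ∧
    ∀ j, (adjacentSums l).2.getD j 0 = if j < l.length then l.getD j 0 + l.getD (j + 1) 0 else 0 := by
  induction l with
  | nil => exact ⟨rfl, rfl, fun j => by simp [adjacentSums]⟩
  | cons a l ih =>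
    obtain ⟨h₁, h₂, h₃⟩ := ih
    have e : adjacentSums (a :: l) = (a, (a + (adjacentSums l).1) :: (adjacentSums l).2) := rfl
    rw [e]
    refine ⟨rfl, by simp [h₂], fun j => ?_⟩
    cases j with
    | zero => simp [h₁]
    | succ j => simpa using h₃ j

/-- The rows of Pascal's triangle. -/
def pascalRow : ℕ → List ℕ
  | 0 => [1]
  | n + 1 => nextRow (pascalRow n)

theorem length_pascalRow (n : ℕ) : (pascalRow n).length = n + 1 := by
  induction n with
  | zero => rfl
  | succ n ih => simp [pascalRow, nextRow, (adjacentSums_spec _).2.1, ih]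

theorem getD_pascalRow (n j : ℕ) : (pascalRow n).getD j 0 = n.choose j := by
  induction n generalizing j with
  | zero => cases j <;> simp [pascalRow]
  | succ n ih =>
    cases j with
    | zero => simp [pascalRow, nextRow]
    | succ j =>
      have h := (adjacentSums_spec (pascalRow n)).2.2 j
      rw [length_pascalRow, ih, ih] at h
      rw [pascalRow, nextRow, List.getD_cons_succ, h, Nat.choose_succ_succ]
      split_ifs with hj
      · rfl
      · rw [Nat.choose_eq_zero_of_lt (by omega), Nat.choose_eq_zero_of_lt (by omega)]

theorem size_pascalRow_le (n : ℕ) : size (pascalRow n) ≤ (n + 1) * (4 * n + 6) + 1 := by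
  refine (size_list_le (B := 4 * n + 5) fun a ha => ?_).trans (by rw [length_pascalRow])
  obtain ⟨j, hj, rfl⟩ := List.getElem_of_mem ha
  have h := getD_pascalRow n j
  rw [List.getD_eq_getElem _ _ hj] at h
  rw [h]
  refine (size_nat_le (k := n + 1) ?_).trans (by omega)
  exact (Nat.choose_le_two_pow n j).trans_lt (Nat.pow_lt_pow_right (by norm_num) (by omega))

theorem size_adjacentSums_le (l : List ℕ) :
    size (adjacentSums l) ≤ (l.length + 1) * (8 * size l + 6) + 3 := by
  obtain ⟨h₁, h₂, h₃⟩ := adjacentSums_spec l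
  have hs : ∀ j, size (l.getD j 0) ≤ size l := by
    intro j
    by_cases hj : j < l.length
    · rw [List.getD_eq_getElem _ _ hj]
      exact size_le_of_mem (List.getElem_mem hj)
    · rw [List.getD_eq_default _ _ (by omega)]
      exact one_le_size l
  have h₄ : size (adjacentSums l).2 ≤ l.length * (8 * size l + 6) + 1 := by
    rw [← h₂]
    refine size_list_le fun a ha => ?_
    obtain ⟨j, hj, rfl⟩ := List.getElem_of_mem ha
    have h := h₃ j
    rw [List.getD_eq_getElem _ _ hj, if_pos (h₂ ▸ hj)] at h
    rw [h]
    refine (size_nat_le (k := 2 * size l + 1) ?_).trans (by omega)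
    have e : ∀ j, l.getD j 0 < 2 ^ (2 * size l) := fun j =>
      (lt_two_pow_size _).trans_le (Nat.pow_le_pow_right (by norm_num) ((hs j).trans (by omega)))
    have := e j
    have := e (j + 1)
    rw [pow_succ]
    omega
  have h₅ : size (adjacentSums l) = size (adjacentSums l).1 + size (adjacentSums l).2 + 1 :=
    size_pair _ _
  have h₆ := hs 0
  rw [h₅, h₁, Nat.add_mul]
  omega

namespace PolyTime

variable {X : Type} [Code X] {m : X → ℕ}

theorem nextRow : PTime nextRow := by
  have h : PTime adjacentSums := by
    refine foldr (X := List ℕ) (l := fun l => l) (s := fun _ => ((0, []) : ℕ × List ℕ))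
      (g := fun _ a s => (a, (a + s.1) :: s.2))
      (B := fun l => (size l + 1) * (8 * size l + 6) + 3) id (const _)
      (id.snd.fst.pair ((id.snd.fst.add id.snd.snd.fst).cons id.snd.snd.snd)) ?_ ?_
    · exact ((PolyBdd.size.add (.const 1)).mul (((PolyBdd.const 8).mul .size).add (.const 6))).add
        (.const 3)
    · intro l l' hl'
      refine (size_adjacentSums_le l').trans ?_
      have h₁ := size_sublist hl'.sublist
      have h₂ := (length_lt_size l').le
      gcongr
      omega
  exact (const 1).cons h.snd

/-- Binomial coefficients of numbers in unary are computable in polynomial time. -/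
theorem choose {a b : X → List Unit} (ha : PolyTime m a) (hb : PolyTime m b) :
    PolyTime m fun x => (a x).length.choose (b x).length := by
  have h₁ : PTime fun l : List Unit => pascalRow l.length := by
    have e : ∀ l : List Unit, l.foldl (fun s _ => SolutionFree.nextRow s) [1] = pascalRow l.length := by
      intro l
      induction l using List.reverseRecOn with
      | nil => rfl
      | append_singleton l a ih => rw [List.foldl_append, ih]; simp [pascalRow]
    refine (foldl (X := List Unit) (l := fun l => l) (s := fun _ => [1])
      (g := fun _ s _ => SolutionFree.nextRow s)
      (B := fun l => (size l + 1) * (4 * size l + 6) + 1) id (const _) (nextRow.comp id.snd.fst)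
      ?_ ?_).congr fun l => (e l).symm
    · exact ((PolyBdd.size.add (.const 1)).mul (((PolyBdd.const 4).mul .size).add (.const 6))).add
        (.const 1)
    · intro l l' hl'
      rw [e]
      refine (size_pascalRow_le _).trans ?_
      have h := hl'.length_le.trans (length_lt_size l).le
      gcongr
  have h₂ : PTime fun y : List ℕ × List Unit => y.1.getD y.2.length 0 := by
    have e : ∀ (l : List Unit) (r : List ℕ), l.foldl (fun s _ => s.tail) r = r.drop l.length := by
      intro l
      induction l with
      | nil => exact fun r => rfl
      | cons a l ih => exact fun r => by rw [List.foldl_cons, ih]; cases r <;> simp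
    have h₃ : PTime fun y : List ℕ × List Unit => y.1.drop y.2.length := by
      refine (foldl (X := List ℕ × List Unit) (l := fun y => y.2) (s := fun y => y.1)
        (g := fun _ s _ => s.tail) (B := size) id.snd id.fst (id.snd.fst.tail) .size ?_).congr
        fun y => (e _ _).symm
      intro y l' hl'
      rw [e]
      refine (size_sublist (List.drop_sublist _ _)).trans ?_
      have := size_pair y.1 y.2
      change size y = _ at this
      omega
    refine (h₃.headD (const 0)).congr fun y => ?_
    rw [List.headD_eq_head?_getD, List.head?_drop, List.getD_eq_getElem?_getD]
  exact (h₂.comp ((h₁.comp ha).pair hb)).congr fun x => (getD_pascalRow _ _).symm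

end PolyTime

/-! ### Non-trivial solutions -/

/-- Triviality is decided by the partition of the index set into the level sets of the solution: a
witnessing partition refines it, and sums of zeros are zero. -/
theorem LinearEquation.isTrivial_iff (L : LinearEquation) (x : Fin L.arity → ℤ) :
    L.IsTrivial x ↔ ∀ i, ∑ j with x j = x i, L.coeff j = 0 := by
  constructor
  · rintro ⟨P, hP⟩ i
    rw [Finset.sum_filter, ← P.biUnion_parts, Finset.sum_biUnion P.disjoint]
    refine Finset.sum_eq_zero fun C hC => ?_
    obtain ⟨h₁, h₂⟩ := hP C hC
    obtain ⟨k, hk⟩ := P.nonempty_of_mem_parts hC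
    by_cases h : x k = x i
    · rw [← h₂]
      exact Finset.sum_congr rfl fun j hj => if_pos ((h₁ j hj k hk).trans h)
    · exact Finset.sum_eq_zero fun j hj => if_neg fun hji => h ((h₁ k hk j hj).trans hji)
  · intro h
    classical
    refine ⟨Finpartition.ofSetoid (Setoid.ker x), fun C hC => ?_⟩
    obtain ⟨i, hi⟩ := (Finpartition.ofSetoid (Setoid.ker x)).nonempty_of_mem_parts hC
    have hC' : C = Finset.univ.filter fun j => x j = x i := by
      rw [← Finpartition.part_eq_of_mem _ hC hi]
      ext j
      rw [Finpartition.mem_part_ofSetoid_iff_rel]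
      simp [Setoid.ker_def, eq_comm]
    subst hC'
    refine ⟨fun j hj k hk => ?_, h i⟩
    rw [(Finset.mem_filter.1 hj).2, (Finset.mem_filter.1 hk).2]

open Classical in
/-- Whether a list of integers is a non-trivial solution of the equation. -/
noncomputable def LinearEquation.bad (L : LinearEquation) (t : List ℤ) : Bool :=
  decide (L.IsSolution (fun i => t.getD i 0) ∧ ¬ L.IsTrivial fun i => t.getD i 0)

theorem LinearEquation.bad_iff {L : LinearEquation} {t : List ℤ} : L.bad t = true ↔
    L.IsSolution (fun i => t.getD i 0) ∧ ¬ L.IsTrivial fun i => t.getD i 0 := by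
  classical simp only [bad, decide_eq_true_eq]

/-- All lists of length `n` with entries in `l`. -/
def tuples : ℕ → List ℤ → List (List ℤ)
  | 0, _ => [[]]
  | n + 1, l => l.flatMap fun a => (tuples n l).map fun t => a :: t

theorem mem_tuples {n : ℕ} {l t : List ℤ} : t ∈ tuples n l ↔ t.length = n ∧ ∀ a ∈ t, a ∈ l := by
  induction n generalizing t with
  | zero =>
    rw [tuples, List.mem_singleton, List.length_eq_zero_iff]
    exact ⟨fun h => ⟨h, by simp [h]⟩, fun h => h.1⟩
  | succ n ih =>
    simp only [tuples, List.mem_flatMap, List.mem_map, ih]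
    constructor
    · rintro ⟨a, ha, t, ⟨h₁, h₂⟩, rfl⟩
      exact ⟨by simp [h₁], by simpa using ⟨ha, h₂⟩⟩
    · rintro ⟨h₁, h₂⟩
      rcases t with _ | ⟨a, t⟩
      · simp at h₁
      · exact ⟨a, h₂ a (by simp), t, ⟨by simpa using h₁, fun b hb => h₂ b (by simp [hb])⟩, rfl⟩

/-- The non-trivial solutions with entries in the list `l`. -/
noncomputable def LinearEquation.edges (L : LinearEquation) (l : List ℤ) : List (List ℤ) :=
  (tuples L.arity l).filter fun t => L.bad t

theorem LinearEquation.isFree_iff (L : LinearEquation) (l : List ℤ) (S : Set ℤ)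
    (hS : ∀ a ∈ S, a ∈ l) : L.IsFree S ↔ ∀ t ∈ L.edges l, ∃ a ∈ t, a ∉ S := by
  constructor
  · intro h t ht
    obtain ⟨h₁, h₂⟩ := List.mem_filter.1 ht
    obtain ⟨h₃, h₄⟩ := mem_tuples.1 h₁
    obtain ⟨h₅, h₆⟩ := LinearEquation.bad_iff.1 h₂
    by_contra! h₇
    refine h₆ (h _ (fun i => ?_) h₅)
    rw [List.getD_eq_getElem _ _ (h₃.symm ▸ i.2)]
    exact h₇ _ (List.getElem_mem _)
  · intro h x hx hs
    by_contra ht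
    have e : (fun i : Fin L.arity => (List.ofFn x).getD i 0) = x := by
      funext i
      rw [List.getD_eq_getElem _ _ (by simp)]
      simp
    have hmem : ∀ a ∈ List.ofFn x, a ∈ S := fun a ha => by
      obtain ⟨i, rfl⟩ := (List.mem_ofFn' _ _).1 ha
      exact hx i
    obtain ⟨a, ha, ha'⟩ := h (List.ofFn x) (List.mem_filter.2
      ⟨mem_tuples.2 ⟨by simp, fun a ha => hS a (hmem a ha)⟩,
        LinearEquation.bad_iff.2 (by rw [e]; exact ⟨hs, ht⟩)⟩)
    exact ha' (hmem a ha)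

namespace PolyTime

variable {X : Type} [Code X] {m : X → ℕ}

theorem natAbs {f : X → ℤ} (hf : PolyTime m f) : PolyTime m fun x => (f x).natAbs :=
  (data_snd.comp hf.toData).of_code_eq fun _ => rfl

theorem isNeg {f : X → ℤ} (hf : PolyTime m f) : PolyTime m fun x => decide (f x < 0) :=
  (data_fst.comp hf.toData).of_code_eq fun _ => rfl

theorem toNat_mul (c : ℤ) {f : X → ℤ} (hf : PolyTime m f) :
    PolyTime m fun x => (c * f x).toNat := by
  rcases lt_or_ge c 0 with hc | hc
  · refine (hf.isNeg.ite (hf.natAbs.const_mul c.natAbs) (const 0)).congr fun x => ?_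
    split_ifs with h
    · rw [decide_eq_true_eq] at h
      rw [← Int.natAbs_mul]
      have := mul_pos_of_neg_of_neg hc h
      omega
    · rw [decide_eq_true_eq, not_lt] at h
      have := mul_nonpos_of_nonpos_of_nonneg hc.le h
      omega
  · refine (hf.isNeg.ite (const 0) (hf.natAbs.const_mul c.natAbs)).congr fun x => ?_
    split_ifs with h
    · rw [decide_eq_true_eq] at h
      have := mul_nonpos_of_nonneg_of_nonpos hc h.le
      omega
    · rw [decide_eq_true_eq, not_lt] at h
      rw [← Int.natAbs_mul]
      have := mul_nonneg hc h
      omega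

theorem finset_sum {ι : Type} (s : Finset ι) {f : ι → X → ℕ} (hf : ∀ i, PolyTime m (f i)) :
    PolyTime m fun x => ∑ i ∈ s, f i x := by
  classical
  induction s using Finset.induction_on with
  | empty => exact (const 0).congr fun x => by simp
  | insert i s hi ih => exact ((hf i).add ih).congr fun x => by rw [Finset.sum_insert hi]

theorem getD (i : ℕ) {l : X → List ℤ} (hl : PolyTime m l) : PolyTime m fun x => (l x).getD i 0 := by
  induction i generalizing l with
  | zero => exact (hl.headD (const 0)).congr fun x => by cases l x <;> rfl
  | succ i ih => exact (ih hl.tail).congr fun x => by cases l x <;> simp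

theorem isSolution (L : LinearEquation) :
    PTime fun t : List ℤ => decide (∑ i, L.coeff i * t.getD i 0 = L.rhs) := by
  -- the positive and the negative terms are added separately
  have h : ∀ c : Fin L.arity → ℤ, PTime fun t : List ℤ => ∑ i, (c i * t.getD i 0).toNat :=
    fun c => finset_sum _ fun i => toNat_mul (c i) (getD i id)
  refine (eq code_injective_nat ((h L.coeff).add (const (-L.rhs).toNat))
    ((h fun i => -L.coeff i).add (const L.rhs.toNat))).congr fun t => ?_
  rw [decide_eq_decide]
  have e : ∑ i, L.coeff i * t.getD i 0 = ((∑ i, (L.coeff i * t.getD i 0).toNat : ℕ) : ℤ) -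
      ((∑ i, (-L.coeff i * t.getD i 0).toNat : ℕ) : ℤ) := by
    rw [Nat.cast_sum, Nat.cast_sum, ← Finset.sum_sub_distrib]
    refine Finset.sum_congr rfl fun i _ => ?_
    rw [neg_mul]
    omega
  rw [e]
  omega

theorem bad (L : LinearEquation) : PTime L.bad := by
  classical
  refine (of_bools (ι := Option (Fin L.arity × Fin L.arity))
    (fun o t => o.elim (decide (∑ i, L.coeff i * t.getD i 0 = L.rhs))
      fun p => decide (t.getD p.1 0 = t.getD p.2 0)) ?_
    (fun v => v none && decide (¬ ∀ i, ∑ j with v (some (j, i)) = true, L.coeff j = 0))).congr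
    fun t => ?_
  · rintro (_ | p)
    · exact isSolution L
    · exact eq code_injective_int (getD _ id) (getD _ id)
  · simp only [LinearEquation.bad, LinearEquation.isTrivial_iff, LinearEquation.IsSolution,
      Option.elim, decide_eq_true_eq, Bool.decide_and]

theorem tuples : ∀ n, PTime (tuples n)
  | 0 => const _
  | n + 1 => flatMap id (f := fun l a => (SolutionFree.tuples n l).map fun t => a :: t)
      (((tuples n).comp id.fst).map (f := fun (y : List ℤ × ℤ) t => y.2 :: t)
        (id.fst.snd.cons id.snd))

theorem edges (L : LinearEquation) : PTime L.edges :=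
  (tuples L.arity).filter (p := fun _ t => L.bad t) ((bad L).comp id.snd)

end PolyTime

/-! ### Counting hitting sets by a search tree -/

/-- The number of `r`-subsets of `U` that meet each of the lists in `E`. -/
def hitCount (U : Finset ℤ) (E : List (List ℤ)) (r : ℕ) : ℕ :=
  ((U.powersetCard r).filter fun D => ∀ e ∈ E, ∃ v ∈ e, v ∈ D).card

/-- A node of the search tree: the sets that remain to be hit, and, in unary, the number of elements
that may still be chosen and the number of elements that have to be chosen among them. -/
abbrev SearchNode := List (List ℤ) × (List Unit × List Unit)

/-- The children of a node: the first element of the first set is either chosen or discarded. A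
node without sets is its own child, and a node with an empty set has no children. -/
def children : SearchNode → List SearchNode
  | ([], y) => [([], y)]
  | ([] :: _, _) => []
  | ((v :: e) :: E, (a, r)) =>
    (if r.isEmpty = true then []
      else [(((v :: e) :: E).filter fun e => !decide (v ∈ e), (a.tail, r.tail))]) ++
    [(((v :: e) :: E).map fun e => e.filter fun w => !decide (w = v), (a.tail, r))]

/-- The number of hitting sets at a node without sets to be hit. -/
def leafCount (y : SearchNode) : ℕ := y.2.1.length.choose y.2.2.length

/-- The sum of `leafCount` over the nodes that are `n` levels below `y`. -/
def levelCount : ℕ → SearchNode → ℕ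
  | 0, y => leafCount y
  | n + 1, y => ((children y).map (levelCount n)).sum

/-- An upper bound for the depth of the search tree, if all sets have at most `k` elements and `r`
elements have to be chosen. -/
def depth (k r : ℕ) : List (List ℤ) → ℕ
  | [] => 0
  | e :: _ => r * (k + 1) + e.length + 1

theorem depth_le {k r : ℕ} {E : List (List ℤ)} (hE : ∀ e ∈ E, e.length ≤ k) :
    depth k r E ≤ (k + 1) * (r + 1) := by
  rcases E with _ | ⟨e, E⟩
  · simp [depth]
  · have := hE e (by simp)
    rw [depth]
    nlinarith

theorem hitCount_nil (U : Finset ℤ) (r : ℕ) : hitCount U [] r = U.card.choose r := by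
  simp [hitCount]

theorem hitCount_nil_cons (U : Finset ℤ) (E : List (List ℤ)) (r : ℕ) :
    hitCount U ([] :: E) r = 0 := by
  simp [hitCount]

theorem forall_filter_iff (E : List (List ℤ)) (v : ℤ) (D : Finset ℤ) :
    (∀ e ∈ E.filter fun e => !decide (v ∈ e), ∃ w ∈ e, w ∈ D) ↔
      ∀ e ∈ E, ∃ w ∈ e, w ∈ insert v D := by
  constructor
  · intro h e he
    by_cases hv : v ∈ e
    · exact ⟨v, hv, Finset.mem_insert_self _ _⟩
    · obtain ⟨w, hw, hw'⟩ := h e (List.mem_filter.2 ⟨he, by simpa using hv⟩)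
      exact ⟨w, hw, Finset.mem_insert_of_mem hw'⟩
  · intro h e he
    obtain ⟨he, hv⟩ := List.mem_filter.1 he
    obtain ⟨w, hw, hw'⟩ := h e he
    rcases Finset.mem_insert.1 hw' with rfl | hw'
    · simp [hw] at hv
    · exact ⟨w, hw, hw'⟩

theorem forall_map_iff (E : List (List ℤ)) {v : ℤ} {D : Finset ℤ} (hD : v ∉ D) :
    (∀ e ∈ E.map fun e => e.filter fun w => !decide (w = v), ∃ w ∈ e, w ∈ D) ↔
      ∀ e ∈ E, ∃ w ∈ e, w ∈ D := by
  simp only [List.mem_map, forall_exists_index, and_imp, forall_apply_eq_imp_iff₂]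
  refine forall₂_congr fun e _ => exists_congr fun w => ?_
  rw [List.mem_filter]
  refine ⟨fun h => ⟨h.1.1, h.2⟩, fun h => ⟨⟨h.1, ?_⟩, h.2⟩⟩
  have : w ≠ v := fun h' => hD (h' ▸ h.2)
  simpa using this

/-- The recursion behind the search tree: a hitting set contains a given element or not. -/
theorem hitCount_erase {U : Finset ℤ} {v : ℤ} (hv : v ∈ U) (E : List (List ℤ)) (r : ℕ) :
    hitCount U E r = (if r = 0 then 0
      else hitCount (U.erase v) (E.filter fun e => !decide (v ∈ e)) (r - 1)) +
      hitCount (U.erase v) (E.map fun e => e.filter fun w => !decide (w = v)) r := by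
  obtain ⟨U, hU, rfl⟩ : ∃ V, v ∉ V ∧ insert v V = U :=
    ⟨U.erase v, Finset.notMem_erase _ _, Finset.insert_erase hv⟩
  rw [Finset.erase_insert hU]
  have h₁ : ∀ r, hitCount U (E.map fun e => e.filter fun w => !decide (w = v)) r =
      ((U.powersetCard r).filter fun D => ∀ e ∈ E, ∃ v ∈ e, v ∈ D).card := by
    intro r
    rw [hitCount]
    congr 1
    refine Finset.filter_congr fun D hD => forall_map_iff E fun h => ?_
    exact hU ((Finset.mem_powersetCard.1 hD).1 h)
  rw [h₁]
  rcases r with _ | r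
  · simp [hitCount]
  · rw [hitCount, Finset.powersetCard_succ_insert hU, Finset.filter_union,
      Finset.card_union_of_disjoint, if_neg r.succ_ne_zero, Nat.add_comm, Finset.filter_image,
      Finset.card_image_of_injOn, Nat.add_sub_cancel, hitCount]
    · congr 2
      exact Finset.filter_congr fun D _ => (forall_filter_iff E v D).symm
    · intro D hD D' hD' h
      have : ∀ D ∈ ((U.powersetCard r).filter fun D => ∀ e ∈ E, ∃ w ∈ e, w ∈ insert v D), v ∉ D :=
        fun D hD h => hU ((Finset.mem_powersetCard.1 (Finset.mem_filter.1 hD).1).1 h)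
      rw [← Finset.erase_insert (this D hD), ← Finset.erase_insert (this D' hD')]
      exact congrArg (fun D => D.erase v) h
    · rw [Finset.disjoint_left]
      intro D hD hD'
      obtain ⟨D', -, rfl⟩ := Finset.mem_image.1 (Finset.mem_filter.1 hD').1
      exact hU ((Finset.mem_powersetCard.1 (Finset.mem_filter.1 hD).1).1
        (Finset.mem_insert_self _ _))

/-- After as many levels as `depth` allows, the leaves of the search tree account for all hitting
sets of the remaining size. -/
theorem levelCount_eq {k : ℕ} : ∀ {n : ℕ} {E : List (List ℤ)} {U : Finset ℤ} {a r : List Unit},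
    (∀ e ∈ E, e.length ≤ k ∧ ∀ v ∈ e, v ∈ U) → a.length = U.card → depth k r.length E ≤ n →
    levelCount n (E, (a, r)) = hitCount U E r.length
  | 0, E, U, a, r, _, ha, hn => by
    rcases E with _ | ⟨e, E⟩
    · rw [hitCount_nil, levelCount, leafCount, ha]
    · simp [depth] at hn
  | n + 1, [], U, a, r, hE, ha, _ => by
    simp [levelCount, children, levelCount_eq (k := k) (n := n) hE ha (Nat.zero_le _)]
  | n + 1, [] :: E, U, a, r, _, _, _ => by
    simp [levelCount, children, hitCount_nil_cons]
  | n + 1, (v :: e) :: E, U, a, r, hE, ha, hn => by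
    have hv : v ∈ U := (hE (v :: e) (by simp)).2 v (by simp)
    have ha' : a.tail.length = (U.erase v).card := by
      rw [List.length_tail, ha, Finset.card_erase_of_mem hv]
    have h₁ : r.isEmpty = false →
        levelCount n (((v :: e) :: E).filter fun e => !decide (v ∈ e), (a.tail, r.tail)) =
        hitCount (U.erase v) (((v :: e) :: E).filter fun e => !decide (v ∈ e)) (r.length - 1) := by
      intro hr
      have hr' : r.length ≠ 0 := fun h => by
        rw [List.length_eq_zero_iff.1 h] at hr
        cases hr
      rw [← List.length_tail]
      refine levelCount_eq (k := k) (fun f hf => ?_) ha' ?_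
      · obtain ⟨hf, hvf⟩ := List.mem_filter.1 hf
        refine ⟨(hE f hf).1, fun w hw => Finset.mem_erase.2 ⟨?_, (hE f hf).2 w hw⟩⟩
        rintro rfl
        simp [hw] at hvf
      · refine (depth_le fun f hf => (hE f (List.mem_of_mem_filter hf)).1).trans ?_
        rw [depth, List.length_cons] at hn
        rw [List.length_tail, Nat.sub_add_cancel (by omega), Nat.mul_comm]
        omega
    have h₂ : levelCount n
          (((v :: e) :: E).map fun e => e.filter fun w => !decide (w = v), (a.tail, r)) =
        hitCount (U.erase v) (((v :: e) :: E).map fun e => e.filter fun w => !decide (w = v))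
          r.length := by
      refine levelCount_eq (k := k) (fun f hf => ?_) ha' ?_
      · obtain ⟨f, hf', rfl⟩ := List.mem_map.1 hf
        refine ⟨(List.length_filter_le _ _).trans (hE f hf').1, fun w hw => ?_⟩
        obtain ⟨hw, hwv⟩ := List.mem_filter.1 hw
        exact Finset.mem_erase.2 ⟨by simpa using hwv, (hE f hf').2 w hw⟩
      · rw [depth, List.length_cons] at hn
        have h₃ : ((v :: e).filter fun w => !decide (w = v)).length ≤ e.length := by
          rw [List.filter_cons_of_neg (by simp)]
          exact List.length_filter_le _ _
        rw [List.map_cons, depth]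
        omega
    rw [hitCount_erase hv, ← h₂, levelCount, children]
    cases hr : r.isEmpty
    · have hr' : r.length ≠ 0 := fun h => by
        rw [List.length_eq_zero_iff.1 h] at hr
        cases hr
      rw [← h₁ hr, if_neg hr']
      simp
    · have hr' : r.length = 0 := by rw [List.isEmpty_iff.1 hr]; rfl
      rw [if_pos hr']
      simp

/-- The nodes `u.length` levels below `y`. -/
def frontier (u : List Unit) (y : SearchNode) : List SearchNode :=
  u.foldl (fun s _ => s.flatMap children) [y]

theorem sum_frontier (u : List Unit) (y : SearchNode) :
    ((frontier u y).map leafCount).sum = levelCount u.length y := by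
  have h : ∀ (u : List Unit) (s : List SearchNode),
      ((u.foldl (fun s _ => s.flatMap children) s).map leafCount).sum =
        (s.map (levelCount u.length)).sum := by
    intro u
    induction u with
    | nil => exact fun s => rfl
    | cons _ u ih =>
      intro s
      rw [List.foldl_cons, ih]
      induction s with
      | nil => rfl
      | cons y s ih' =>
        rw [List.flatMap_cons, List.map_append, List.sum_append, ih', List.map_cons, List.sum_cons]
        rfl
  rw [frontier, h]
  simp

theorem size_map_le {α : Type} [Code α] {l : List α} {f : α → α} (h : ∀ a, size (f a) ≤ size a) :
    size (l.map f) ≤ size l := by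
  induction l with
  | nil => rfl
  | cons a l ih =>
    have := h a
    simp only [List.map_cons, size_cons]
    omega

theorem length_children_le (y : SearchNode) : (children y).length ≤ 2 := by
  rcases y with ⟨_ | ⟨_ | ⟨v, e⟩, E⟩, a, r⟩
  · simp [children]
  · simp [children]
  · rw [children]
    split_ifs <;> simp

theorem size_children_le {y z : SearchNode} (h : z ∈ children y) : size z ≤ size y := by
  rcases y with ⟨_ | ⟨_ | ⟨v, e⟩, E⟩, a, r⟩
  · rw [children, List.mem_singleton] at h
    rw [h]
  · simp [children] at h
  · have h₁ : size (((v :: e) :: E).filter fun e => !decide (v ∈ e)) ≤ size ((v :: e) :: E) :=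
      size_sublist List.filter_sublist
    have h₂ : size (((v :: e) :: E).map fun e => e.filter fun w => !decide (w = v)) ≤
        size ((v :: e) :: E) := size_map_le fun f => size_sublist List.filter_sublist
    have h₃ := size_sublist (List.tail_sublist a)
    have h₄ := size_sublist (List.tail_sublist r)
    rw [children, List.mem_append, List.mem_singleton] at h
    rcases h with h | rfl
    · split_ifs at h
      · simp at h
      · rw [List.mem_singleton] at h
        subst h
        rw [size_pair, size_pair, size_pair, size_pair]
        omega
    · rw [size_pair, size_pair, size_pair, size_pair]
      omega

theorem size_frontier_le (u : List Unit) (y : SearchNode) :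
    size (frontier u y) ≤ 2 ^ u.length * (size y + 1) + 1 := by
  have h : ∀ (u : List Unit) (s : List SearchNode), (∀ z ∈ s, size z ≤ size y) →
      (u.foldl (fun s _ => s.flatMap children) s).length ≤ 2 ^ u.length * s.length ∧
      ∀ z ∈ u.foldl (fun s _ => s.flatMap children) s, size z ≤ size y := by
    intro u
    induction u with
    | nil => exact fun s hs => ⟨by simp, hs⟩
    | cons _ u ih =>
      intro s hs
      obtain ⟨h₁, h₂⟩ := ih (s.flatMap children) fun z hz => by
        obtain ⟨w, hw, hz⟩ := List.mem_flatMap.1 hz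
        exact (size_children_le hz).trans (hs w hw)
      refine ⟨h₁.trans ?_, h₂⟩
      have h₃ : (s.flatMap children).length ≤ 2 * s.length := by
        clear hs h₁ h₂
        induction s with
        | nil => simp
        | cons z s ih' =>
          have := length_children_le z
          rw [List.flatMap_cons, List.length_append, List.length_cons]
          omega
      calc 2 ^ u.length * (s.flatMap children).length ≤ 2 ^ u.length * (2 * s.length) :=
            Nat.mul_le_mul_left _ h₃
        _ = _ := by rw [List.length_cons, pow_succ]; ring
  obtain ⟨h₁, h₂⟩ := h u [y] (by simp)
  refine (size_list_le h₂).trans ?_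
  rw [List.length_singleton, Nat.mul_one] at h₁
  exact Nat.succ_le_succ (Nat.mul_le_mul_right _ h₁)

namespace PolyTime

variable {X : Type} [Code X] {m : X → ℕ}

theorem children : PTime children := by
  have hz : Function.Injective (code : ℤ → Data) := code_injective_int
  -- the argument is the node, its first set, the other sets, the first element, the other elements
  have h₁ : PTime fun y : (SearchNode × (List ℤ × List (List ℤ))) × (ℤ × List ℤ) =>
      (if y.1.1.2.2.isEmpty = true then []
        else [(y.1.1.1.filter fun e => !decide (y.2.1 ∈ e), (y.1.1.2.1.tail, y.1.1.2.2.tail))]) ++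
      [(y.1.1.1.map fun e => e.filter fun w => !decide (w = y.2.1),
        (y.1.1.2.1.tail, y.1.1.2.2))] := by
    refine append (ite id.fst.fst.snd.snd.isEmpty (const [])
      (cons (pair ?_ (id.fst.fst.snd.fst.tail.pair id.fst.fst.snd.snd.tail)) (const [])))
      (cons (pair ?_ (id.fst.fst.snd.fst.tail.pair id.fst.fst.snd.snd)) (const []))
    · exact filter (p := fun (y : (SearchNode × (List ℤ × List (List ℤ))) × (ℤ × List ℤ)) e =>
        !decide (y.2.1 ∈ e)) id.fst.fst.fst (not (mem hz id.fst.snd.fst id.snd))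
    · exact map (f := fun (y : (SearchNode × (List ℤ × List (List ℤ))) × (ℤ × List ℤ)) e =>
        e.filter fun w => !decide (w = y.2.1)) id.fst.fst.fst
        (filter (p := fun (y : ((SearchNode × (List ℤ × List (List ℤ))) × (ℤ × List ℤ)) × List ℤ) w =>
          !decide (w = y.1.2.1)) id.snd (not (eq hz id.snd id.fst.fst.snd.fst)))
  have h₂ : PTime fun y : SearchNode × (List ℤ × List (List ℤ)) => (match y.2.1 with
      | [] => []
      | v :: _ => (if y.1.2.2.isEmpty = true then []
        else [(y.1.1.filter fun e => !decide (v ∈ e), (y.1.2.1.tail, y.1.2.2.tail))]) ++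
        [(y.1.1.map fun e => e.filter fun w => !decide (w = v), (y.1.2.1.tail, y.1.2.2))] :
        List SearchNode) :=
    list_cases id.snd.fst (const []) h₁ (fun y h => by simp only [h]) fun y v e h => by simp only [h]
  refine list_cases (f := fun y => [y]) id.fst (id.cons (const [])) h₂ ?_ ?_
  · rintro ⟨_, y⟩ rfl
    rfl
  · rintro ⟨_, y⟩ e E rfl
    cases e <;> rfl

/-- The search to the depth `u x` takes polynomial time relative to `2 ^ (u x).length`. -/
theorem frontier {u : X → List Unit} {y : X → SearchNode} (hu : PolyTime m u) (hy : PolyTime m y)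
    (hm : PolyBdd m fun x => 2 ^ (u x).length) :
    PolyTime m fun x => frontier (u x) (y x) := by
  refine hu.foldl (s := fun x => [y x]) (g := fun _ s _ => s.flatMap SolutionFree.children)
    (B := fun x => 2 ^ (u x).length * (size (y x) + 1) + 1) (hy.cons (const []))
    (flatMap (f := fun _ y => SolutionFree.children y) id.snd.fst (children.comp id.snd))
    ((hm.mul (hy.size_bdd.add (.const 1))).add (.const 1)) fun x l hl => ?_
  refine (size_frontier_le l (y x)).trans ?_
  gcongr
  · norm_num
  · exact hl.length_le

end PolyTime

/-! ### Reading instances -/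

/-- The sign and the binary digits of an integer. -/
def signBits (z : ℤ) : Bool × List Bool := (decide (z < 0), Computability.encodeNat z.natAbs)

/-- Processing of one symbol of the input, which is read from right to left. The state consists of
the numbers that have been read completely and the sign and the digits of the current number. -/
def readStep (s : List (Bool × List Bool) × (Bool × List Bool)) :
    Symbol → List (Bool × List Bool) × (Bool × List Bool)
  | .bit b => (s.1, (s.2.1, b :: s.2.2))
  | .minus => (s.1, (true, s.2.2))
  | .comma => (s.2 :: s.1, (false, []))

theorem foldr_readStep_bits (l : List Bool) (s : List (Bool × List Bool) × (Bool × List Bool)) :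
    (l.map Symbol.bit).foldr (fun a s => readStep s a) s = (s.1, (s.2.1, l ++ s.2.2)) := by
  induction l with
  | nil => rfl
  | cons b l ih => rw [List.map_cons, List.foldr_cons, ih]; rfl

theorem foldr_readStep_encodeInt (z : ℤ) (u : List (Bool × List Bool)) :
    (encodeInt z).foldr (fun a s => readStep s a) (u, (false, [])) = (u, signBits z) := by
  rw [encodeInt, List.foldr_append, encodeNat, foldr_readStep_bits, List.append_nil]
  split_ifs with h <;> simp [readStep, signBits, h]

theorem foldr_readStep_elems (l : List ℤ) (s : List (Bool × List Bool) × (Bool × List Bool)) :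
    let s' := (l.flatMap fun z => encodeInt z ++ [Symbol.comma]).foldr (fun a s => readStep s a) s
    s'.2 :: s'.1 = l.map signBits ++ s.2 :: s.1 := by
  induction l with
  | nil => rfl
  | cons z l ih =>
    simp only [List.flatMap_cons, List.foldr_append, List.map_cons, List.cons_append, ← ih,
      List.foldr_cons, List.foldr_nil]
    exact congrArg (fun s : List (Bool × List Bool) × (Bool × List Bool) => s.2 :: s.1)
      (foldr_readStep_encodeInt z _)

/-- The numbers of an instance as they are listed in the input: the elements of the set, followed
by the required size. -/
def Instance.numbers (I : Instance) : List ℤ := I.elems ++ [(I.k : ℤ)]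

theorem Instance.foldl_readStep (I : Instance) :
    let s := I.encode.reverse.foldl readStep ([], (false, []))
    s.2 :: s.1 = I.numbers.map signBits := by
  have h := foldr_readStep_elems I.elems ([], (false, Computability.encodeNat I.k))
  rw [List.foldl_reverse, Instance.encode, List.foldr_append, encodeNat, foldr_readStep_bits,
    List.append_nil]
  refine h.trans ?_
  rw [Instance.numbers, List.map_append]
  congr 1

/-- The length of a list as a number, compared with `k`: the first component counts the elements up
to `k`, the second one counts, in unary, the remaining elements. -/
def excess (k : ℕ) (l : List ℤ) : ℕ × List Unit :=
  l.foldl (fun s _ => if decide (s.1 = k) = true then (s.1, () :: s.2) else (s.1 + 1, s.2)) (0, [])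

theorem excess_eq (k : ℕ) (l : List ℤ) :
    excess k l = (min l.length k, List.replicate (l.length - k) ()) := by
  induction l using List.reverseRecOn with
  | nil => simp [excess]
  | append_singleton l a ih =>
    have e : excess k (l ++ [a]) = if decide ((excess k l).1 = k) = true
        then ((excess k l).1, () :: (excess k l).2) else ((excess k l).1 + 1, (excess k l).2) := by
      rw [excess, List.foldl_append]
      rfl
    rw [e, ih, List.length_append, List.length_singleton]
    simp only [decide_eq_true_eq]
    split_ifs with h
    · rw [show l.length + 1 - k = (l.length - k) + 1 by omega, List.replicate_succ,
        show min (l.length + 1) k = min l.length k by omega]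
    · rw [show l.length + 1 - k = l.length - k by omega,
        show min (l.length + 1) k = min l.length k + 1 by omega]

theorem size_units (l : List Unit) : size l = 2 * l.length + 1 := by
  induction l with
  | nil => rfl
  | cons _ l ih => rw [size_cons, ih, List.length_cons, size_unit]; ring

namespace PolyTime

variable {X : Type} [Code X] {m : X → ℕ}

theorem readStep : PTime fun y : (List (Bool × List Bool) × (Bool × List Bool)) × Symbol =>
    readStep y.1 y.2 := by
  have h : ∀ s : Symbol, PTime fun y : (List (Bool × List Bool) × (Bool × List Bool)) × Symbol =>
      decide (y.2 = s) := fun s => eq code_injective_symbol id.snd (const s)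
  have hf : PTime fun y : (List (Bool × List Bool) × (Bool × List Bool)) × Symbol => y.1.1 :=
    id.fst.fst
  have hd : PTime fun y : (List (Bool × List Bool) × (Bool × List Bool)) × Symbol => y.1.2.2 :=
    id.fst.snd.snd
  refine ((h .comma).ite ((id.fst.snd.cons hf).pair (const (false, [])))
    ((h .minus).ite (hf.pair ((const true).pair hd))
      (hf.pair (id.fst.snd.fst.pair ((h (.bit true)).cons hd))))).congr ?_
  rintro ⟨s, (_ | _) | _ | _⟩ <;> rfl

theorem numbers : PTime Instance.numbers := by
  have h₁ : PTime fun w : List Symbol => w.foldl SolutionFree.readStep ([], (false, [])) := by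
    refine foldl (X := List Symbol) (l := fun w => w) (s := fun _ => ([], (false, [])))
      (g := fun _ s a => SolutionFree.readStep s a) (B := fun w => 4 * size w + 10)
      id (const _) (readStep.comp id.snd) (((PolyBdd.const 4).mul .size).add (.const 10)) ?_
    intro w u hu
    have h : ∀ (u : List Symbol) (s : List (Bool × List Bool) × (Bool × List Bool)),
        size (u.foldl SolutionFree.readStep s) ≤ size s + 4 * u.length := by
      intro u
      induction u with
      | nil => exact fun s => le_rfl
      | cons a u ih =>
        intro s
        refine (ih _).trans ?_
        have h : size (SolutionFree.readStep s a) ≤ size s + 4 := by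
          obtain ⟨f, b, l⟩ := s
          rcases a with b' | _ | _
          · have := size_bool_le b'
            simp only [SolutionFree.readStep, size_pair, size_cons]
            omega
          · have := one_le_size b
            have := size_bool_le true
            simp only [SolutionFree.readStep, size_pair]
            omega
          · have : size false = 1 := rfl
            simp only [SolutionFree.readStep, size_pair, size_cons, size_nil]
            omega
        rw [List.length_cons]
        omega
    refine (h u _).trans ?_
    have h₁ := hu.length_le.trans (length_lt_size w).le
    have h₂ : size (([], (false, [])) : List (Bool × List Bool) × (Bool × List Bool)) = 5 := rfl
    omega
  have h₂ : PTime fun I : Instance => I.encode.reverse := id.of_code_eq fun _ => rfl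
  have h₃ : PTime fun I : Instance => I.encode.reverse.foldl SolutionFree.readStep ([], (false, [])) :=
    h₁.comp h₂
  refine (h₃.snd.cons h₃.fst).of_code_eq fun I => ?_
  rw [I.foldl_readStep]
  change Data.ofList _ = Data.ofList _
  rw [List.map_map]
  rfl

theorem elems : PTime Instance.elems :=
  numbers.reverse.tail.reverse.congr fun I => by simp [Instance.numbers]

theorem targetSize : PTime Instance.k :=
  (numbers.reverse.headD (const 0)).natAbs.congr fun I => by simp [Instance.numbers]

theorem excess {k : X → ℕ} {l : X → List ℤ} (hk : PolyTime m k) (hl : PolyTime m l) :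
    PolyTime m fun x => excess (k x) (l x) := by
  have h : PTime fun y : ℕ × List ℤ => SolutionFree.excess y.1 y.2 := by
    have h₁ : PTime fun z : (ℕ × List ℤ) × ((ℕ × List Unit) × ℤ) => decide (z.2.1.1 = z.1.1) :=
      eq code_injective_nat id.snd.fst.fst id.fst.fst
    have h₂ : PTime fun z : (ℕ × List ℤ) × ((ℕ × List Unit) × ℤ) => (z.2.1.1, () :: z.2.1.2) :=
      id.snd.fst.fst.pair ((const ()).cons id.snd.fst.snd)
    have h₃ : PTime fun z : (ℕ × List ℤ) × ((ℕ × List Unit) × ℤ) => (z.2.1.1 + 1, z.2.1.2) :=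
      (id.snd.fst.fst.add (const 1)).pair id.snd.fst.snd
    refine foldl (X := ℕ × List ℤ) (l := fun y => y.2) (s := fun _ => ((0, []) : ℕ × List Unit))
      (g := fun y s _ => if decide (s.1 = y.1) = true then (s.1, () :: s.2) else (s.1 + 1, s.2))
      (B := fun y => 6 * size y + 3) id.snd (const _) (h₁.ite h₂ h₃)
      (((PolyBdd.const 6).mul .size).add (.const 3)) ?_
    intro y l' hl'
    change size (SolutionFree.excess y.1 l') ≤ _
    have h₁ := hl'.length_le.trans (length_lt_size y.2).le
    have h₂ : size y = size y.1 + size y.2 + 1 := size_pair y.1 y.2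
    have h₃ : size (min l'.length y.1) ≤ 4 * l'.length + 1 :=
      size_nat_le ((min_le_left _ _).trans_lt Nat.lt_two_pow_self)
    rw [excess_eq, size_pair, size_units, List.length_replicate]
    omega
  exact (h.comp (hk.pair hl) :)

theorem length {α : Type} [Code α] {l : X → List α} (hl : PolyTime m l) :
    PolyTime m fun x => (l x).length :=
  (hl.map (f := fun _ _ => 1) (const 1)).sum.congr fun x => by simp

end PolyTime

/-! ### The counting problem -/

theorem Instance.card_set (I : Instance) : I.set.card = I.elems.length :=
  List.toFinset_card_of_nodup I.nodup

theorem Instance.excess_eq (I : Instance) :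
    (excess I.k I.elems).2.length = I.set.card - I.k ∧
      ((excess I.k I.elems).1 = I.k ↔ I.k ≤ I.set.card) := by
  rw [SolutionFree.excess_eq, I.card_set]
  simp

open Classical in
/-- In the definition of `numFree`, the filter is elaborated over the image of `A.powersetCard k`
in `Finset (Set ℤ)`. The coercion to sets is injective, so the number of finsets is the same. -/
theorem LinearEquation.numFree_eq_card (L : LinearEquation) (A : Finset ℤ) (k : ℕ) :
    L.numFree A k = ((A.powersetCard k).filter fun B : Finset ℤ => L.IsFree (B : Set ℤ)).card := by
  rw [← Finset.card_image_of_injective (β := Set ℤ) _ Finset.coe_injective, numFree]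
  congr 1
  ext B
  simp only [Finset.mem_filter, Finset.mem_image, Finset.bind_def, Finset.pure_def, Finset.mem_sup,
    Finset.mem_singleton]
  constructor
  · rintro ⟨⟨B, hB, rfl⟩, h⟩
    exact ⟨B, ⟨hB, h⟩, rfl⟩
  · rintro ⟨B, ⟨hB, h⟩, rfl⟩
    exact ⟨⟨B, hB, rfl⟩, h⟩

open Classical in
/-- Complements of free sets are the sets that meet all non-trivial solutions. -/
theorem numFree_eq_hitCount (L : LinearEquation) (I : Instance) (hk : I.k ≤ I.set.card) :
    L.numFree I.set I.k = hitCount I.set (L.edges I.elems) (I.set.card - I.k) := by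
  have hmem : ∀ {a : ℤ}, a ∈ I.set ↔ a ∈ I.elems := List.mem_toFinset
  have hfree : ∀ B : Finset ℤ, B ⊆ I.set → (L.IsFree (B : Set ℤ) ↔
      ∀ t ∈ L.edges I.elems, ∃ a ∈ t, a ∈ I.set \ B) := by
    intro B hB
    rw [L.isFree_iff I.elems B fun a ha => hmem.1 (hB ha)]
    refine forall₂_congr fun t ht => exists_congr fun a => and_congr_right fun ha => ?_
    rw [Finset.mem_sdiff, Finset.mem_coe, hmem]
    have := (mem_tuples.1 (List.mem_of_mem_filter ht)).2 a ha
    simp [this]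
  rw [L.numFree_eq_card, hitCount]
  refine Finset.card_nbij' (fun B => I.set \ B) (fun D => I.set \ D) ?_ ?_ ?_ ?_
  · intro B hB
    obtain ⟨h₁, h₂⟩ := Finset.mem_filter.1 hB
    obtain ⟨h₃, h₄⟩ := Finset.mem_powersetCard.1 h₁
    refine Finset.mem_filter.2 ⟨Finset.mem_powersetCard.2 ⟨Finset.sdiff_subset, ?_⟩,
      (hfree B h₃).1 h₂⟩
    rw [Finset.card_sdiff_of_subset h₃, h₄]
  · intro D hD
    obtain ⟨h₁, h₂⟩ := Finset.mem_filter.1 hD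
    obtain ⟨h₃, h₄⟩ := Finset.mem_powersetCard.1 h₁
    refine Finset.mem_filter.2 ⟨Finset.mem_powersetCard.2 ⟨Finset.sdiff_subset, ?_⟩,
      (hfree _ Finset.sdiff_subset).2 ?_⟩
    · rw [Finset.card_sdiff_of_subset h₃, h₄]
      omega
    · rwa [Finset.sdiff_sdiff_eq_self h₃]
  · intro B hB
    exact Finset.sdiff_sdiff_eq_self
      (Finset.mem_powersetCard.1 (Finset.mem_filter.1 hB).1).1
  · intro D hD
    exact Finset.sdiff_sdiff_eq_self
      (Finset.mem_powersetCard.1 (Finset.mem_filter.1 hD).1).1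

/-- The depth to which the search tree is explored, in unary. -/
def searchDepth (L : LinearEquation) (I : Instance) : List Unit :=
  (() :: (excess I.k I.elems).2).flatMap fun _ => List.replicate (L.arity + 1) ()

theorem length_searchDepth (L : LinearEquation) (I : Instance) :
    (searchDepth L I).length = (L.arity + 1) * (I.set.card - I.k + 1) := by
  rw [searchDepth, List.length_flatMap]
  simp [I.excess_eq.1]
  ring

/-- The root of the search tree. -/
noncomputable def searchRoot (L : LinearEquation) (I : Instance) : SearchNode :=
  (L.edges I.elems, (I.elems.map fun _ => (), (excess I.k I.elems).2))

theorem numFree_eq (L : LinearEquation) (I : Instance) :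
    L.numFree I.set I.k = if decide ((excess I.k I.elems).1 = I.k) = true then
      ((frontier (searchDepth L I) (searchRoot L I)).map leafCount).sum else 0 := by
  simp only [decide_eq_true_eq, I.excess_eq.2]
  split_ifs with hk
  · have hE : ∀ t ∈ L.edges I.elems, t.length ≤ L.arity ∧ ∀ v ∈ t, v ∈ I.set := by
      intro t ht
      obtain ⟨h₁, h₂⟩ := mem_tuples.1 (List.mem_of_mem_filter ht)
      exact ⟨h₁.le, fun v hv => List.mem_toFinset.2 (h₂ v hv)⟩
    rw [sum_frontier, numFree_eq_hitCount L I hk, searchRoot, levelCount_eq (k := L.arity) hE,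
      I.excess_eq.1]
    · rw [List.length_map, I.card_set]
    · rw [length_searchDepth, I.excess_eq.1]
      exact depth_le fun e he => (hE e he).1
  · rw [L.numFree_eq_card, Finset.powersetCard_eq_empty.2 (by omega)]
    simp

namespace PolyTime

theorem excessOfInstance : PTime fun I : Instance => SolutionFree.excess I.k I.elems :=
  excess targetSize elems

theorem kappa : PTime fun I : Instance => I.set.card - I.k :=
  excessOfInstance.snd.length.congr fun I => I.excess_eq.1.symm

theorem numFree (L : LinearEquation) :
    PolyTime (fun I : Instance => 2 ^ ((L.arity + 1) * (I.set.card - I.k + 1)))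
      fun I => L.numFree I.set I.k := by
  have hd : PTime fun I : Instance => (SolutionFree.excess I.k I.elems).2 := excessOfInstance.snd
  have hu : PTime (searchDepth L) :=
    ((const ()).cons hd).flatMap (f := fun _ _ => List.replicate (L.arity + 1) ()) (const _)
  have hy : PTime (searchRoot L) :=
    ((edges L).comp elems).pair ((elems.map (f := fun _ _ => ()) (const ())).pair hd)
  have hc : PTime leafCount := choose id.snd.fst id.snd.snd
  refine (ite (of_pTime (eq code_injective_nat excessOfInstance.fst targetSize))
    (((of_pTime hu).frontier (of_pTime hy) (PolyBdd.measure.mono fun I => ?_)).map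
      (f := fun _ y => leafCount y) (hc.comp id.snd)).sum (const 0)).congr (numFree_eq L)
  rw [length_searchDepth]

end PolyTime

theorem ComputableWithin.mono {α Γ : Type} {enc : α → List Γ} {F t t' : α → ℕ}
    (h : ComputableWithin enc F t) (ht : ∀ x, t x ≤ t' x) : ComputableWithin enc F t' := by
  obtain ⟨M, hM, h⟩ := h
  exact ⟨M, hM, fun x => (h x).map fun y => ⟨y.toEvalsTo, y.steps_le_m.trans (ht x)⟩⟩

theorem size_instance_le (I : Instance) : size I ≤ 8 * I.encode.length + 1 := by
  have h : size I = size I.encode.reverse := rfl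
  rw [h]
  refine (size_list_le (B := 7) fun s _ => ?_).trans (by rw [List.length_reverse, Nat.mul_comm])
  rcases s with (_ | _) | _ | _ <;> exact le_rfl

/-- Programs provide Turing machines: the input is loaded, the program is run, and its result is
written to the output. -/
theorem PolyTime.computableWithin {m F : Instance → ℕ} (hF : PolyTime m F) :
    ∃ c, ComputableWithin Instance.encode F fun I => (m I + 8 * I.encode.length + 3) ^ c := by
  obtain ⟨p, T, hT, hp⟩ := hF
  have hB : PolyBdd m fun I => 11 * T I + 10 * size I + 7 :=
    (((PolyBdd.const 11).mul hT).add ((PolyBdd.const 10).mul .size)).add (.const 7)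
  obtain ⟨c, hc⟩ := hB
  refine ⟨c, (computableWithin_of_exec (t := fun I => (m I + size I + 2) ^ c)
    (Prog.loadInput ;; p ;; Prog.writeOutput) fun I => ?_).mono fun I => ?_⟩
  · obtain ⟨v₁, h₁⟩ := Prog.exec_loadInput I.encode ⟨none, none, none⟩
    obtain ⟨v₂, t₂, ht₂, h₂⟩ := (hp I).2 [] v₁
    rw [List.append_nil, List.append_nil] at h₂
    obtain ⟨v₃, t₃, ht₃, h₃⟩ := Prog.exec_writeOutput (Computability.encodeNat (F I)) v₂
    refine ⟨_, le_trans ?_ (hc I), v₃, .seq h₁ (.seq h₂ h₃)⟩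
    dsimp only
    have h₄ := (length_lt_size (Computability.encodeNat (F I))).le.trans (hp I).1
    have h₅ : I.encode.reverse.length ≤ size I := (length_lt_size I.encode.reverse).le
    rw [List.length_reverse] at h₅
    omega
  · have := size_instance_le I
    exact Nat.pow_le_pow_left (by omega) c

end SolutionFree

theorem theorem7p1 (L : SolutionFree.LinearEquation) :
    SolutionFree.CountingInFPT SolutionFree.Instance.encode
      (fun I => L.numFree I.set I.k)
      (fun I => I.set.card - I.k) := by
  constructor
  · obtain ⟨c, hc⟩ := SolutionFree.PolyTime.kappa.computableWithin
    refine ⟨(8 * Polynomial.X + 3) ^ c, hc.mono fun I => ?_⟩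
    simp
  · obtain ⟨c, hc⟩ := (SolutionFree.PolyTime.numFree L).computableWithin
    refine ⟨fun n => (2 ^ ((L.arity + 1) * (n + 1))) ^ c, (8 * Polynomial.X + 4) ^ c, ?_,
      hc.mono fun I => ?_⟩
    · have hpow : Primrec₂ fun a b : ℕ => a ^ b := Primrec₂.unpaired'.1 Nat.Primrec.pow
      exact (hpow.comp (hpow.comp (.const 2) (Primrec.nat_mul.comp (.const _) .succ))
        (.const c)).to_comp
    · have h : 1 ≤ 2 ^ ((L.arity + 1) * (I.set.card - I.k + 1)) := Nat.one_le_two_pow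
      simp only [Polynomial.eval_pow, Polynomial.eval_add, Polynomial.eval_mul,
        Polynomial.eval_ofNat, Polynomial.eval_X]
      rw [← mul_pow]
      refine Nat.pow_le_pow_left ?_ c
      nlinarith
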